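/- **Setting.** Let $\mathcal Y$ be a measurable space with a measure $\nu$, $h\ge 0$ and $T$ measurable functions on $\mathcal Y$, and let $f(y\mid t)=h(y)\exp(tT(y)-A(t))$ with $A(t)=\log\int h\,e^{tT}\,d\nu$ be the associated exponential family. Let $M>0$ be such that $[-M,M]$ lies in the interior of the natural parameter set $\{t:\int h e^{tT}d\nu<\infty\}$, assume that $A$ is twice continuously differentiable on this interior and that $\operatorname{Var}_t[T(Y)]>0$ for all $t\in[-M,M]$. Let $K\subseteq[-M,M]^n$ be star-shaped with respect to one of its points (in particular non-empty), with Euclidean diameter $d$. One observes independent $Y_1,\dots,Y_n$ with $Y_i\sim f(\cdot\mid\theta_i)$, where $\theta\in K$. **Local entropy.** A $\delta$-packing set of a set is a finite subset whose distinct points are at distance $>\delta$; it is maximal if it is maximal under inclusion. Let $N^{\rm loc}(\varepsilon,a)$ be the supremum over $x\in K$ of the largest cardinality of an $\varepsilon/a$-packing set of $B(x,\varepsilon)\cap K$ ($B$ denotes closed Euclidean balls). For $C>0$ put $c=2(C+1)$ and for $\kappa>0$ $$\varepsilon_J=\frac{d}{2^{J-1}(C+1)}\quad(J\ge1),\qquad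 \varepsilon^*=\sup\{\varepsilon\ge 0:\kappa\varepsilon^2\le\log N^{\rm loc}(\varepsilon,c)\},$$ and let $J^*$ be the maximal $J\ge1$ with $$\kappa\varepsilon_J^2>\max\bigl(2\log\bigl([N^{\rm loc}(c\varepsilon_J,2c)]^2\bigr),\ \log 2\bigr),$$ with $J^*=1$ if there is no such $J$. **Pruned tree.** Level 1 is a point $\Upsilon_1\in K$; level 2, the offspring of $\Upsilon_1$, is a maximal $d/c$-packing set of $B(\Upsilon_1,d)\cap K=K$. For $k\ge3$, choose for each node $u$ of level $k-1$ a maximal $d/(2^{k-1}c)$-packing set of $B(u,d/2^{k-2})\cap K$ and draw edges from $u$ to its points. List the union of these sets in lexicographic order. As long as the list is non-empty, take its first element $v$; for every other element $w$ of the list with $\|w-v\|\le d/(2^{k-1}c)$ redirect all edges pointing to $w$ to $v$; then delete $v$ and all these $w$ from the list. The points $v$ so selected form level $k$. $\mathcal O(u)$ is the set of the offspring of $u$ in the resulting graph. **Algorithm.** A point $\beta$ dominates $\alpha$ if $\sum_{i}\bigl[(\alpha_i-\beta_i)T(Y_i)+A(\beta_i)-A(\alpha_i)\bigr]\le0$.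 For a finite set $S$ let $H(\delta,\alpha,S)$ be the largest $\|\alpha-\beta\|$ over those $\beta\in S$ that dominate $\alpha$ and satisfy $\|\alpha-\beta\|\ge C\delta$, and $0$ if there is no such $\beta$. Starting from $\Upsilon_1$, iteration $k\ge1$ lets $\Upsilon_{k+1}$ be a minimiser of $\alpha\mapsto H\bigl(\tfrac{d}{2^k(C+1)},\alpha,\mathcal O(\Upsilon_k)\bigr)$ over $\mathcal O(\Upsilon_k)$, the lexicographically smallest one in case of ties. **Theorem.** There is a $C_0>0$ depending only on $M$ and the exponential family such that for every $C\ge C_0$ and every $\kappa>0$ there is an $L>0$, depending only on $M$, the exponential family, $C$ and $\kappa$, with the following property. For all $n$, all $K$ as above, all $\Upsilon_1\in K$, all choices of the maximal packing sets in the tree, all $\theta\in K$ and every $\theta^{**}=\Upsilon_k$ with $k\ge J^*$ (in particular for the output $\Upsilon_{k+1}$ after any number $k\ge J^*$ of iterations), $\|\theta^{**}-\theta\|^2$ is integrable and $$\mathbb E_\theta\|\theta^{**}-\theta\|^2\le L\,(\varepsilon_{J^*}^2\wedge d^2)\qquad\text{and}\qquad \mathbb E_\theta\|\theta^{**}-\theta\|^2\le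 L\,(\varepsilon^{*2}\wedge d^2).$$ -/

import Mathlib

open MeasureTheory ProbabilityTheory
open scoped NNReal ENNReal

namespace StarExpFamily

noncomputable section

/-! ### The exponential family -/

/-- The data of a one-parameter exponential family in natural form: a dominating measure, a carrier
function `h ≥ 0` and a sufficient statistic `T` on an arbitrary observation space. -/
structure ExpFamily (𝒴 : Type*) [MeasurableSpace 𝒴] where
  base : Measure 𝒴
  h : 𝒴 → ℝ
  measurable_h : Measurable h
  h_nonneg : ∀ y, 0 ≤ h y
  T : 𝒴 → ℝ
  measurable_T : Measurable T

namespace ExpFamily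

variable {𝒴 : Type*} [MeasurableSpace 𝒴] (F : ExpFamily 𝒴)

/-- The natural parameters `t` for which `h(y) exp(t T(y))` can be normalised. -/
def naturalSpace : Set ℝ :=
  {t | Integrable (fun y => F.h y * Real.exp (t * F.T y)) F.base}

/-- The cumulant function `A(t) = log ∫ h(y) exp(t T(y)) dy`, which makes
`h(y) exp(t T(y) - A(t))` a probability density. -/
def cumulant (t : ℝ) : ℝ :=
  Real.log (∫ y, F.h y * Real.exp (t * F.T y) ∂F.base)

/-- The law with density `f(y | t) = h(y) exp(t T(y) - A(t))`. -/
def law (t : ℝ) : Measure 𝒴 :=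
  F.base.withDensity fun y => ENNReal.ofReal (F.h y * Real.exp (t * F.T y - F.cumulant t))

/-- The joint law of independent observations `Y i` with law `law (θ i)`. -/
def jointLaw {n : ℕ} (θ : EuclideanSpace ℝ (Fin n)) : Measure (Fin n → 𝒴) :=
  Measure.pi fun i => F.law (θ i)

end ExpFamily

variable {n : ℕ}

/-! ### Packings and local entropy -/

/-- `S` is a maximal (with respect to inclusion) `δ`-packing set of `K`. -/
def IsMaximalPacking (δ : ℝ) (K : Set (EuclideanSpace ℝ (Fin n)))
    (S : Finset (EuclideanSpace ℝ (Fin n))) : Prop :=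
  Maximal (fun S : Finset (EuclideanSpace ℝ (Fin n)) =>
    (S : Set (EuclideanSpace ℝ (Fin n))) ⊆ K ∧
      ∀ x ∈ S, ∀ y ∈ S, x ≠ y → δ < ‖x - y‖) S

/-- `N^loc(ε, c)`: the supremum over `θ ∈ K` of the largest cardinality of an `ε / c`-packing set of
`B(θ, ε) ∩ K`. -/
def localPackingNumber (K : Set (EuclideanSpace ℝ (Fin n))) (ε c : ℝ) : ℕ∞ :=
  ⨆ θ ∈ K, Metric.packingNumber (ε / c).toNNReal (Metric.closedBall θ ε ∩ K)

/-- `N^loc(ε, c)` as a real number (for `K` bounded and `ε, c > 0` it is finite). -/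
def Nloc (K : Set (EuclideanSpace ℝ (Fin n))) (ε c : ℝ) : ℝ :=
  ((localPackingNumber K ε c).toNat : ℝ)

/-- `ε_J = d / (2^{J-1} (C+1))`, `J ≥ 1`, where `d = diam K`. -/
def epsJ (K : Set (EuclideanSpace ℝ (Fin n))) (C : ℝ) (J : ℕ) : ℝ :=
  Metric.diam K / (2 ^ (J - 1) * (C + 1))

/-- The condition `κ ε_J² > 2 log [N^loc(c ε_J, 2c)]² ∨ log 2`, where `c = 2(C+1)`. -/
def JCondition (K : Set (EuclideanSpace ℝ (Fin n))) (κ C : ℝ) (J : ℕ) : Prop :=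
  κ * epsJ K C J ^ 2 >
    max (2 * Real.log (Nloc K (2 * (C + 1) * epsJ K C J) (2 * (2 * (C + 1))) ^ 2)) (Real.log 2)

/-- `J*`: the maximal `J ≥ 1` satisfying `JCondition`, and `1` if there is none. -/
def Jstar (K : Set (EuclideanSpace ℝ (Fin n))) (κ C : ℝ) : ℕ :=
  max 1 (sSup {J : ℕ | 1 ≤ J ∧ JCondition K κ C J})

/-- `ε* = sup {ε ≥ 0 : κ ε² ≤ log N^loc(ε, c)}`, where `c = 2(C+1)`. -/
def epsStar (K : Set (EuclideanSpace ℝ (Fin n))) (κ C : ℝ) : ℝ :=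
  sSup {ε : ℝ | 0 ≤ ε ∧ κ * ε ^ 2 ≤ Real.log (Nloc K ε (2 * (C + 1)))}

/-! ### The pruned tree

Depth `m` below is level `m + 1` of the tree: the root has depth `0`. -/

/-- The lexicographic order on points. -/
def lexLE (x y : EuclideanSpace ℝ (Fin n)) : Prop := toLex x.ofLp ≤ toLex y.ofLp

instance : DecidableRel (lexLE (n := n)) := fun _ _ => Classical.propDecidable _
instance : IsTrans (EuclideanSpace ℝ (Fin n)) lexLE := ⟨fun _ _ _ h h' => le_trans h h'⟩
instance : Std.Antisymm (lexLE (n := n)) :=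
  ⟨fun _ _ h h' => WithLp.ofLp_injective 2 (toLex.injective (le_antisymm h h'))⟩
instance : Std.Total (lexLE (n := n)) := ⟨fun x y => le_total (toLex x.ofLp) (toLex y.ofLp)⟩

/-- The finite set `S`, listed in lexicographic order. -/
def lexList (S : Finset (EuclideanSpace ℝ (Fin n))) : List (EuclideanSpace ℝ (Fin n)) :=
  S.sort lexLE

/-- The radius of the packing that produces depth `m + 1` from depth `m`:
`d / c` for the first step and `d / (2^{m+1} c)` afterwards. -/
def packRadius (d c : ℝ) (m : ℕ) : ℝ :=
  if m = 0 then d / c else d / (2 ^ (m + 1) * c)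

/-- `pack` is a choice of the packings out of which the tree is built: `pack m u` is a maximal
packing of `B(u, d / 2^m) ∩ K`, to be used when the node `u` occurs at depth `m`. -/
def IsPackingChoice (K : Set (EuclideanSpace ℝ (Fin n))) (c : ℝ)
    (pack : ℕ → EuclideanSpace ℝ (Fin n) → Finset (EuclideanSpace ℝ (Fin n))) : Prop :=
  ∀ m : ℕ, ∀ u ∈ K, IsMaximalPacking (packRadius (Metric.diam K) c m)
    (Metric.closedBall u (Metric.diam K / 2 ^ m) ∩ K) (pack m u)

/-- The pruning pass over the list of unprocessed nodes. The first unprocessed node `u` absorbs all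
unprocessed nodes within distance `r`; these and `u` are removed from the list, and the pass goes on
with the rest. The value at `v` is the node that absorbs `v`, i.e. the node to which an edge
pointing to `v` is redirected. -/
def pruneRep (r : ℝ) : List (EuclideanSpace ℝ (Fin n)) → EuclideanSpace ℝ (Fin n) →
    EuclideanSpace ℝ (Fin n)
  | [], v => v
  | u :: l, v =>
      if ‖v - u‖ ≤ r then u else pruneRep r (l.filter fun w => decide (r < ‖w - u‖)) v
termination_by l => l.length
decreasing_by
  rw [List.length_unattach, List.length_cons]
  exact Nat.lt_succ_of_le ((List.length_filter_le _ _).trans_eq List.length_attach)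

open Classical in
/-- The offspring of the node `u` at depth `m`, when `L` is the set of all nodes at depth `m`. -/
def offspring (d c : ℝ)
    (pack : ℕ → EuclideanSpace ℝ (Fin n) → Finset (EuclideanSpace ℝ (Fin n)))
    (m : ℕ) (L : Finset (EuclideanSpace ℝ (Fin n))) (u : EuclideanSpace ℝ (Fin n)) :
    Finset (EuclideanSpace ℝ (Fin n)) :=
  if m = 0 then pack 0 u
  else (pack m u).image (pruneRep (packRadius d c m) (lexList (L.biUnion (pack m))))

open Classical in
/-- The nodes at depth `m` of the pruned tree with root `root`. -/
def nodes (d c : ℝ) (root : EuclideanSpace ℝ (Fin n))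
    (pack : ℕ → EuclideanSpace ℝ (Fin n) → Finset (EuclideanSpace ℝ (Fin n))) :
    ℕ → Finset (EuclideanSpace ℝ (Fin n))
  | 0 => {root}
  | m + 1 => (nodes d c root pack m).biUnion (offspring d c pack m (nodes d c root pack m))

/-! ### The likelihood-based algorithm -/

variable {𝒴 : Type*} [MeasurableSpace 𝒴]

/-- `β` dominates `α` given the data `Y`. -/
def Dominates (F : ExpFamily 𝒴) (Y : Fin n → 𝒴) (β α : EuclideanSpace ℝ (Fin n)) : Prop :=
  ∑ i, ((α i - β i) * F.T (Y i) + F.cumulant (β i) - F.cumulant (α i)) ≤ 0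

open Classical in
/-- `H(δ, α, S)`: the largest distance from `α` to a point of `S` which dominates `α` and is at
distance at least `C δ` from it, and `0` if there is no such point. -/
def H (F : ExpFamily 𝒴) (Y : Fin n → 𝒴) (C δ : ℝ) (α : EuclideanSpace ℝ (Fin n))
    (S : Finset (EuclideanSpace ℝ (Fin n))) : ℝ≥0 :=
  (S.filter fun β => Dominates F Y β α ∧ C * δ ≤ ‖α - β‖).sup fun β => ‖α - β‖₊

/-- The output `Υ_{m+1}` of `m` iterations of the algorithm started at `Υ_1 = root`, with `d = diam K`
and `c = 2(C+1)`. Iteration `k = m + 1` moves to the offspring that minimises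
`H(d / (2^k (C+1)), ·, offspring)`, the lexicographically smallest one in case of ties. -/
def output (F : ExpFamily 𝒴) (K : Set (EuclideanSpace ℝ (Fin n))) (C : ℝ)
    (root : EuclideanSpace ℝ (Fin n))
    (pack : ℕ → EuclideanSpace ℝ (Fin n) → Finset (EuclideanSpace ℝ (Fin n)))
    (Y : Fin n → 𝒴) : ℕ → EuclideanSpace ℝ (Fin n)
  | 0 => root
  | m + 1 =>
      let d := Metric.diam K
      let c := 2 * (C + 1)
      let u := output F K C root pack Y m
      let S := offspring d c pack m (nodes d c root pack m) u
      ((lexList S).argmin fun θ => H F Y C (d / (2 ^ (m + 1) * (C + 1))) θ S).getD u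

end

end StarExpFamily

/-!
The proof follows the iterates of the algorithm through the scales `d / 2 ^ m`, where
`d = diam K`.

*One comparison.* If `α` is within `δ` of the true `θ` and `β` is at distance at least `C δ` from
`α`, then `β` dominates `α` with probability at most `exp (-q ‖α - β‖²)`
(`ExpFamily.exists_dominates_prob_le`). This is Chernoff's bound for the log-likelihood ratio: the
second derivative of the cumulant is the variance of `T`, so it is bounded away from zero on
`[-M, M]` and bounded above near it. The gain from strong convexity is quadratic in `‖α - β‖`, and
the loss from `α ≠ θ` is at most `‖α - θ‖ ‖α - β‖` up to a constant, hence negligible for large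
`C`.

*One iteration.* Pruning keeps the nodes of each level separated (`nodes_sep`) while the offspring
of a node still cover its ball (`exists_near_offspring`). If the current iterate is within
`d / 2 ^ m` of `θ`, some offspring `α` is within `δ = d / (2 ^ m c)` of `θ`. Unless a far
offspring dominates `α`, minimality of `H` puts the next iterate within `C δ` of `α`, thus within
`d / 2 ^ (m + 1)` of `θ`. The iterate is random, so a union bound is taken over all nodes within
`d / 2 ^ m` of `θ` and over their offspring; both are counted by the local packing number
(`exists_failure_event`).

*Risk.* Steps decay geometrically, so if the first failure is at stage `j`, the final error is at
most `5 d / 2 ^ j`. For a star-shaped set the local packing number decreases with the scale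
(`Nloc_anti`); therefore the condition defining `J*` controls the entropy at all coarser scales,
and the sum of the failure probabilities times the squared scales is dominated by its last term
(`integral_norm_output_sub_sq_le`). When `κ` exceeds the constant of the comparison bound,
finitely many levels are given up, which costs a constant factor.

*Critical scale.* The condition defining `J*` fails one level further down. Packing numbers with
radii differing by a factor two are comparable (`Nloc_two_mul_le_sq`), and a star-shaped set
contains two well separated points at each scale up to `d / 4` (`two_le_Nloc`); so `ε_{J*}` is at
most `6 ε*` (`epsJ_Jstar_le`), and the second bound follows from the first.
-/

namespace StarExpFamily

noncomputable section

/-! ### Exponential families and likelihood comparisons -/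

section Likelihood

namespace ExpFamily

variable {𝒴 : Type*} [MeasurableSpace 𝒴] (F : ExpFamily 𝒴)

/-- The carrier measure `h dν`; the laws of the family are its exponential tilts. -/
def carrier : Measure 𝒴 := F.base.withDensity fun y => ENNReal.ofReal (F.h y)

lemma integrable_carrier_iff (t : ℝ) :
    Integrable (fun y => Real.exp (t * F.T y)) F.carrier ↔ t ∈ F.naturalSpace := by
  rw [carrier, integrable_withDensity_iff_integrable_smul' F.measurable_h.ennreal_ofReal
    (ae_of_all _ fun _ => ENNReal.ofReal_lt_top)]
  simp only [naturalSpace, Set.mem_ofPred_eq, smul_eq_mul, ENNReal.toReal_ofReal (F.h_nonneg _)]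

lemma naturalSpace_eq_integrableExpSet : F.naturalSpace = integrableExpSet F.T F.carrier :=
  Set.ext fun t => (F.integrable_carrier_iff t).symm

lemma mgf_carrier (t : ℝ) :
    mgf F.T F.carrier t = ∫ y, F.h y * Real.exp (t * F.T y) ∂F.base := by
  rw [mgf, carrier, integral_withDensity_eq_integral_toReal_smul F.measurable_h.ennreal_ofReal
    (ae_of_all _ fun _ => ENNReal.ofReal_lt_top)]
  simp only [smul_eq_mul, ENNReal.toReal_ofReal (F.h_nonneg _)]

lemma cumulant_eq_cgf : F.cumulant = cgf F.T F.carrier := by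
  ext t
  rw [cumulant, cgf, mgf_carrier]

lemma law_eq_tilted (hF : F.carrier ≠ 0) {t : ℝ} (ht : t ∈ F.naturalSpace) :
    F.law t = F.carrier.tilted (fun y => t * F.T y) := by
  have : NeZero F.carrier := ⟨hF⟩
  rw [Measure.tilted, carrier, ← withDensity_mul _ F.measurable_h.ennreal_ofReal
    (by have := F.measurable_T; fun_prop), law]
  congr 1
  ext y
  have h1 : ∫ x, Real.exp (t * F.T x) ∂F.carrier = Real.exp (F.cumulant t) := by
    rw [cumulant_eq_cgf, exp_cgf ((F.integrable_carrier_iff t).2 ht), mgf]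
  rw [Pi.mul_apply, ← carrier, h1, ← ENNReal.ofReal_mul (F.h_nonneg y), Real.exp_sub]

lemma isProbabilityMeasure_law (hF : F.carrier ≠ 0) {t : ℝ} (ht : t ∈ F.naturalSpace) :
    IsProbabilityMeasure (F.law t) := by
  have : NeZero F.carrier := ⟨hF⟩
  rw [F.law_eq_tilted hF ht]
  exact isProbabilityMeasure_tilted ((F.integrable_carrier_iff t).2 ht)

lemma carrier_ne_zero_of_variance_pos {t : ℝ} (h : 0 < variance F.T (F.law t)) :
    F.carrier ≠ 0 := by
  intro h0
  have h1 : F.law t = 0 := by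
    have h2 : F.law t ≪ F.carrier := by
      have : F.law t = F.carrier.withDensity
          (fun y => ENNReal.ofReal (Real.exp (t * F.T y - F.cumulant t))) := by
        rw [carrier, ← withDensity_mul _ F.measurable_h.ennreal_ofReal
          (by have := F.measurable_T; fun_prop), law]
        congr 1
        ext y
        rw [Pi.mul_apply, ENNReal.ofReal_mul (F.h_nonneg y)]
      rw [this]
      exact withDensity_absolutelyContinuous _ _
    rw [h0] at h2
    exact Measure.absolutelyContinuous_zero_iff.1 h2
  simp [h1] at h

lemma integrable_exp_law (hF : F.carrier ≠ 0) {t s : ℝ} (ht : t ∈ F.naturalSpace)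
    (hs : t + s ∈ F.naturalSpace) : Integrable (fun y => Real.exp (s * F.T y)) (F.law t) := by
  rw [F.law_eq_tilted hF ht, integrable_tilted_iff ((F.integrable_carrier_iff t).2 ht)]
  refine ((F.integrable_carrier_iff _).2 hs).congr (ae_of_all _ fun y => ?_)
  simp only [smul_eq_mul, ← Real.exp_add]
  ring_nf

lemma integral_exp_law (hF : F.carrier ≠ 0) {t s : ℝ} (ht : t ∈ F.naturalSpace)
    (hs : t + s ∈ F.naturalSpace) :
    ∫ y, Real.exp (s * F.T y) ∂(F.law t) = Real.exp (F.cumulant (t + s) - F.cumulant t) := by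
  have : NeZero F.carrier := ⟨hF⟩
  rw [F.law_eq_tilted hF ht, integral_exp_tilted, Real.exp_sub, cumulant_eq_cgf,
    exp_cgf ((F.integrable_carrier_iff t).2 ht), exp_cgf ((F.integrable_carrier_iff _).2 hs),
    mgf, mgf]
  congr 3
  ext y
  simp only [Pi.add_apply]
  ring_nf

end ExpFamily

/-- Second-order lower Taylor bound on an interval. -/
lemma add_deriv_mul_add_sq_le {f : ℝ → ℝ} {p q b : ℝ}
    (hf : ∀ x ∈ Set.Icc p q, AnalyticAt ℝ f x)
    (hb : ∀ x ∈ Set.Icc p q, b ≤ iteratedDeriv 2 f x) {x y : ℝ}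
    (hx : x ∈ Set.Icc p q) (hy : y ∈ Set.Icc p q) :
    f x + deriv f x * (y - x) + b / 2 * (y - x) ^ 2 ≤ f y := by
  have hd : ∀ z ∈ Set.Icc p q, HasDerivAt f (deriv f z) z := fun z hz =>
    (hf z hz).differentiableAt.hasDerivAt
  have hd2 : ∀ z ∈ Set.Icc p q, HasDerivAt (deriv f) (iteratedDeriv 2 f z) z := fun z hz => by
    rw [iteratedDeriv_succ, iteratedDeriv_one]
    exact (hf z hz).deriv.differentiableAt.hasDerivAt
  have hm : MonotoneOn (fun z => deriv f z - b * z) (Set.Icc p q) := by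
    have h (z) (hz : z ∈ Set.Icc p q) :
        HasDerivAt (fun z => deriv f z - b * z) (iteratedDeriv 2 f z - b) z := by
      simpa using (hd2 z hz).fun_sub ((hasDerivAt_id z).const_mul b)
    refine monotoneOn_of_deriv_nonneg (convex_Icc p q)
      (fun z hz => (h z hz).continuousAt.continuousWithinAt)
      (fun z hz => (h z (interior_subset hz)).differentiableAt.differentiableWithinAt)
      (fun z hz => ?_)
    rw [(h z (interior_subset hz)).deriv]
    linarith [hb z (interior_subset hz)]
  have hg (z) (hz : z ∈ Set.Icc p q) :
      HasDerivAt (fun z => f z - b / 2 * z ^ 2) (deriv f z - b * z) z := by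
    have := (hd z hz).fun_sub ((hasDerivAt_pow 2 z).const_mul (b / 2))
    exact this.congr_deriv (by push_cast; ring)
  have hc : ConvexOn ℝ (Set.Icc p q) (fun z => f z - b / 2 * z ^ 2) := by
    refine MonotoneOn.convexOn_of_deriv (convex_Icc p q)
      (fun z hz => (hg z hz).continuousAt.continuousWithinAt)
      (fun z hz => (hg z (interior_subset hz)).differentiableAt.differentiableWithinAt) ?_
    refine (hm.mono interior_subset).congr fun z hz => ?_
    exact (hg z (interior_subset hz)).deriv.symm
  have key : (deriv f x - b * x) * (y - x) ≤ (f y - b / 2 * y ^ 2) - (f x - b / 2 * x ^ 2) := by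
    rcases lt_trichotomy x y with h | h | h
    · have := hc.le_slope_of_hasDerivAt hx hy h (hg x hx)
      rw [slope_def_field, le_div_iff₀ (by linarith)] at this
      exact this
    · subst h; simp
    · have := hc.slope_le_of_hasDerivAt hy hx h (hg x hx)
      rw [slope_def_field, div_le_iff₀ (by linarith)] at this
      linarith
  nlinarith [key]

/-- Second-order upper Taylor bound on an interval. -/
lemma le_add_deriv_mul_add_sq {f : ℝ → ℝ} {p q B : ℝ}
    (hf : ∀ x ∈ Set.Icc p q, AnalyticAt ℝ f x)
    (hB : ∀ x ∈ Set.Icc p q, iteratedDeriv 2 f x ≤ B) {x y : ℝ}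
    (hx : x ∈ Set.Icc p q) (hy : y ∈ Set.Icc p q) :
    f y ≤ f x + deriv f x * (y - x) + B / 2 * (y - x) ^ 2 := by
  have h := add_deriv_mul_add_sq_le (f := -f) (b := -B) (fun z hz => (hf z hz).neg)
    (fun z hz => by
      rw [iteratedDeriv_neg]
      have := hB z hz
      simpa using this) hx hy
  rw [deriv.neg'] at h
  simp only [Pi.neg_apply] at h
  linarith

namespace ExpFamily

variable {𝒴 : Type*} [MeasurableSpace 𝒴] (F : ExpFamily 𝒴)

/-- The curvature of the cumulant is bounded below on the parameter range, because it is the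
variance of the sufficient statistic, and bounded above on a slightly larger interval, which is
still inside the natural parameter space. -/
lemma exists_curvature_bounds {M : ℝ} (hM : 0 < M)
    (hnat : Set.Icc (-M) M ⊆ interior F.naturalSpace)
    (hvar : ∀ t ∈ Set.Icc (-M) M, 0 < variance F.T (F.law t)) :
    ∃ η > 0, ∃ b > 0, ∃ B > 0, Set.Icc (-M - η) (M + η) ⊆ interior F.naturalSpace ∧
      (∀ t ∈ Set.Icc (-M) M, b ≤ iteratedDeriv 2 F.cumulant t) ∧
      ∀ t ∈ Set.Icc (-M - η) (M + η), iteratedDeriv 2 F.cumulant t ≤ B := by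
  have hF : F.carrier ≠ 0 :=
    F.carrier_ne_zero_of_variance_pos (hvar 0 ⟨by linarith, hM.le⟩)
  have han : ∀ t ∈ interior F.naturalSpace, AnalyticAt ℝ F.cumulant t := fun t ht => by
    rw [cumulant_eq_cgf]
    rw [naturalSpace_eq_integrableExpSet] at ht
    exact analyticAt_cgf ht
  have hcont : ContinuousOn (iteratedDeriv 2 F.cumulant) (interior F.naturalSpace) :=
    fun t ht => (han t ht).iterated_deriv 2 |>.continuousAt.continuousWithinAt.congr_of_eventuallyEq
      (by simp [iteratedDeriv_eq_iterate]) (by simp [iteratedDeriv_eq_iterate])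
  obtain ⟨η, hη, hsub⟩ := isCompact_Icc.exists_cthickening_subset_open isOpen_interior hnat
  have hsub' : Set.Icc (-M - η) (M + η) ⊆ interior F.naturalSpace := fun t ht => hsub <| by
    refine Metric.mem_cthickening_of_dist_le t (max (-M) (min t M)) η _
      ⟨le_max_left _ _, max_le (by linarith) (min_le_right _ _)⟩ ?_
    have h1 := ht.1
    have h2 := ht.2
    rw [Real.dist_eq, abs_le]
    rcases le_total t M with h | h
    · rw [min_eq_left h]
      rcases le_total (-M) t with h' | h'
      · rw [max_eq_right h']
        constructor <;> linarith
      · rw [max_eq_left h']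
        constructor <;> linarith
    · rw [min_eq_right h, max_eq_right (by linarith)]
      constructor <;> linarith
  obtain ⟨t₀, ht₀, hmin⟩ := isCompact_Icc.exists_isMinOn
    (Set.nonempty_Icc.2 (by linarith : -M ≤ M)) (hcont.mono hnat)
  obtain ⟨t₁, ht₁, hmax⟩ := isCompact_Icc.exists_isMaxOn
    (Set.nonempty_Icc.2 (by linarith : -M - η ≤ M + η)) (hcont.mono hsub')
  have hpos : ∀ t ∈ Set.Icc (-M) M, 0 < iteratedDeriv 2 F.cumulant t := fun t ht => by
    have h1 := hvar t ht
    have h2 := hnat ht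
    rw [F.law_eq_tilted hF (interior_subset h2)] at h1
    rw [naturalSpace_eq_integrableExpSet] at h2
    rwa [variance_tilted_mul h2, ← cumulant_eq_cgf] at h1
  refine ⟨η, hη, _, hpos t₀ ht₀, max 1 (iteratedDeriv 2 F.cumulant t₁), by positivity, hsub',
    fun t ht => hmin ht, fun t ht => le_max_of_le_right (hmax ht)⟩

/-- The exponential moment of the log-likelihood ratio of one observation. -/
lemma integral_exp_logLikelihoodRatio (hF : F.carrier ≠ 0) {t l x y : ℝ} (ht : t ∈ F.naturalSpace)
    (hs : t + l * (y - x) ∈ F.naturalSpace) :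
    ∫ w, Real.exp (l * ((y - x) * F.T w - F.cumulant y + F.cumulant x)) ∂(F.law t) =
      Real.exp (F.cumulant (t + l * (y - x)) - F.cumulant t
        - l * (F.cumulant y - F.cumulant x)) := by
  have h : ∀ w, Real.exp (l * ((y - x) * F.T w - F.cumulant y + F.cumulant x)) =
      Real.exp (l * (y - x) * F.T w) * Real.exp (-(l * (F.cumulant y - F.cumulant x))) := by
    intro w
    rw [← Real.exp_add]
    ring_nf
  simp_rw [h]
  rw [integral_mul_const, F.integral_exp_law hF ht hs, ← Real.exp_add, ← sub_eq_add_neg]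

lemma integrable_exp_logLikelihoodRatio (hF : F.carrier ≠ 0) {t l x y : ℝ}
    (ht : t ∈ F.naturalSpace) (hs : t + l * (y - x) ∈ F.naturalSpace) :
    Integrable (fun w => Real.exp (l * ((y - x) * F.T w - F.cumulant y + F.cumulant x)))
      (F.law t) := by
  refine ((F.integrable_exp_law hF ht hs).mul_const
    (Real.exp (-(l * (F.cumulant y - F.cumulant x))))).congr (ae_of_all _ fun w => ?_)
  simp only [← Real.exp_add]
  ring_nf

/-- A likelihood comparison between a point `α` close to the truth and a point `β` that is much
further from `α` goes wrong with a probability that is Gaussian in the distance `‖α - β‖`: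
Chernoff's bound with a fixed small exponent. -/
lemma exists_dominates_prob_le {M : ℝ} (hM : 0 < M)
    (hnat : Set.Icc (-M) M ⊆ interior F.naturalSpace)
    (hvar : ∀ t ∈ Set.Icc (-M) M, 0 < variance F.T (F.law t)) :
    ∃ C₀ ≥ 1, ∃ q > 0, ∀ C ≥ C₀, ∀ (n : ℕ) (θ α β : EuclideanSpace ℝ (Fin n)) (δ : ℝ),
      (∀ i, θ i ∈ Set.Icc (-M) M) → (∀ i, α i ∈ Set.Icc (-M) M) →
      (∀ i, β i ∈ Set.Icc (-M) M) → ‖α - θ‖ ≤ δ → C * δ ≤ ‖α - β‖ →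
      (F.jointLaw θ).real {Y | Dominates F Y β α} ≤ Real.exp (-(q * ‖α - β‖ ^ 2)) := by
  have hF : F.carrier ≠ 0 :=
    F.carrier_ne_zero_of_variance_pos (hvar 0 ⟨by linarith, hM.le⟩)
  obtain ⟨η, hη, b, hb, B, hB, hsub, hlow, hup⟩ := F.exists_curvature_bounds hM hnat hvar
  have han : ∀ t ∈ Set.Icc (-M - η) (M + η), AnalyticAt ℝ F.cumulant t := fun t ht => by
    have ht := hsub ht
    rw [cumulant_eq_cgf]
    rw [naturalSpace_eq_integrableExpSet] at ht
    exact analyticAt_cgf ht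
  have hIcc : Set.Icc (-M) M ⊆ Set.Icc (-M - η) (M + η) :=
    Set.Icc_subset_Icc (by linarith) (by linarith)
  -- The exponent keeps the tilted parameter in the natural space and makes the second-order term
  -- of the upper bound at most a quarter of the gain from the lower bound.
  set l := min (η / (2 * M)) (b / (4 * B)) with hl
  have hl0 : 0 < l := lt_min (by positivity) (by positivity)
  have hl1 : l * (2 * M) ≤ η := by
    have := min_le_left (η / (2 * M)) (b / (4 * B))
    rwa [← hl, le_div_iff₀ (by positivity)] at this
  have hl2 : l * (4 * B) ≤ b := by
    have := min_le_right (η / (2 * M)) (b / (4 * B))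
    rwa [← hl, le_div_iff₀ (by positivity)] at this
  -- For `C ≥ 8 B / b` the loss caused by `α ≠ θ` is at most a quarter of that gain.
  refine ⟨max 1 (8 * B / b), le_max_left _ _, l * b / 4, by positivity, ?_⟩
  intro C hC n θ α β δ hθ hα hβ h1 h2
  have hC1 : 1 ≤ C := (le_max_left _ _).trans hC
  have hC2 : 8 * B ≤ C * b := by
    have := (le_max_right _ _).trans hC
    rwa [div_le_iff₀ hb] at this
  have hprob : ∀ i, IsProbabilityMeasure (F.law (θ i)) := fun i =>
    F.isProbabilityMeasure_law hF (interior_subset (hnat (hθ i)))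
  have hmem : ∀ i, θ i + l * (β i - α i) ∈ Set.Icc (-M - η) (M + η) := fun i => by
    obtain ⟨a1, a2⟩ := hθ i
    obtain ⟨a3, a4⟩ := hα i
    obtain ⟨a5, a6⟩ := hβ i
    have u1 : l * (β i - α i) ≤ l * (2 * M) := by gcongr; linarith
    have u2 : l * (-(2 * M)) ≤ l * (β i - α i) := by gcongr; linarith
    constructor <;> nlinarith
  have hmem' : ∀ i, θ i + l * (β i - α i) ∈ F.naturalSpace := fun i =>
    interior_subset (hsub (hmem i))
  have hθ' : ∀ i, θ i ∈ F.naturalSpace := fun i => interior_subset (hnat (hθ i))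
  set X : (Fin n → 𝒴) → ℝ := fun Y =>
    ∑ i, ((β i - α i) * F.T (Y i) - F.cumulant (β i) + F.cumulant (α i)) with hX
  have hexp : ∀ Y, Real.exp (l * X Y) = ∏ i, Real.exp (l *
      ((β i - α i) * F.T (Y i) - F.cumulant (β i) + F.cumulant (α i))) := fun Y => by
    rw [hX, Finset.mul_sum, Real.exp_sum]
  have hint : Integrable (fun Y => Real.exp (l * X Y)) (F.jointLaw θ) := by
    simp_rw [hexp]
    exact Integrable.fintype_prod fun i =>
      F.integrable_exp_logLikelihoodRatio hF (hθ' i) (hmem' i)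
  have hset : {Y | Dominates F Y β α} = {Y | 0 ≤ X Y} := by
    ext Y
    have : ∑ i, ((α i - β i) * F.T (Y i) + F.cumulant (β i) - F.cumulant (α i)) = - X Y := by
      rw [hX, ← Finset.sum_neg_distrib]
      exact Finset.sum_congr rfl fun i _ => by ring
    simp only [Set.mem_ofPred_eq, Dominates, this, Left.neg_nonpos_iff]
  have : IsProbabilityMeasure (F.jointLaw θ) := by unfold jointLaw; infer_instance
  rw [hset]
  refine (measure_ge_le_exp_mul_mgf 0 hl0.le hint).trans ?_
  have hmgf : mgf X (F.jointLaw θ) l = Real.exp (∑ i, (F.cumulant (θ i + l * (β i - α i))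
      - F.cumulant (θ i) - l * (F.cumulant (β i) - F.cumulant (α i)))) := by
    rw [mgf]
    simp_rw [hexp]
    rw [jointLaw, integral_fintype_prod_eq_prod (fun i w => Real.exp (l *
      ((β i - α i) * F.T w - F.cumulant (β i) + F.cumulant (α i)))), Real.exp_sum]
    exact Finset.prod_congr rfl fun i _ =>
      F.integral_exp_logLikelihoodRatio hF (hθ' i) (hmem' i)
  rw [hmgf, mul_zero, Real.exp_zero, one_mul, Real.exp_le_exp]
  have hA' : ∀ x ∈ Set.Icc (-M) M, ∀ y ∈ Set.Icc (-M) M,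
      |deriv F.cumulant x - deriv F.cumulant y| ≤ B * |x - y| := by
    intro x hx y hy
    have hd : ∀ z ∈ Set.Icc (-M) M,
        HasDerivWithinAt (deriv F.cumulant) (iteratedDeriv 2 F.cumulant z) (Set.Icc (-M) M) z := by
      intro z hz
      rw [iteratedDeriv_succ, iteratedDeriv_one]
      exact (han z (hIcc hz)).deriv.differentiableAt.hasDerivAt.hasDerivWithinAt
    have := (convex_Icc (-M) M).norm_image_sub_le_of_norm_hasDerivWithin_le hd (C := B)
      (fun z hz => by
        rw [Real.norm_eq_abs, abs_of_nonneg (hb.le.trans (hlow z hz))]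
        exact hup z (hIcc hz)) hy hx
    simpa [Real.norm_eq_abs] using this
  have hterm : ∀ i, F.cumulant (θ i + l * (β i - α i)) - F.cumulant (θ i)
      - l * (F.cumulant (β i) - F.cumulant (α i)) ≤
      l * B * (|α i - θ i| * |α i - β i|) + (l * l * B / 2 - l * b / 2) * |α i - β i| ^ 2 := by
    intro i
    have t1 := le_add_deriv_mul_add_sq han hup (hIcc (hθ i)) (hmem i)
    have t2 := add_deriv_mul_add_sq_le (fun x hx => han x (hIcc hx)) hlow (hα i) (hβ i)
    have t3 : (deriv F.cumulant (θ i) - deriv F.cumulant (α i)) * (β i - α i) ≤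
        B * |α i - θ i| * |α i - β i| := by
      refine (le_abs_self _).trans ?_
      rw [abs_mul, abs_sub_comm (β i), abs_sub_comm (α i) (θ i)]
      gcongr
      exact hA' _ (hθ i) _ (hα i)
    rw [sq_abs]
    have t4 := mul_le_mul_of_nonneg_left t2 hl0.le
    have t5 := mul_le_mul_of_nonneg_left t3 hl0.le
    nlinarith
  refine (Finset.sum_le_sum fun i _ => hterm i).trans ?_
  rw [Finset.sum_add_distrib, ← Finset.mul_sum, ← Finset.mul_sum]
  have hsq : ∑ i, |α i - β i| ^ 2 = ‖α - β‖ ^ 2 := by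
    simp [EuclideanSpace.norm_sq_eq]
  have hsq' : ∑ i, |α i - θ i| ^ 2 = ‖α - θ‖ ^ 2 := by
    simp [EuclideanSpace.norm_sq_eq]
  have hcs : ∑ i, |α i - θ i| * |α i - β i| ≤ ‖α - θ‖ * ‖α - β‖ := by
    refine (Real.sum_mul_le_sqrt_mul_sqrt _ _ _).trans_eq ?_
    rw [hsq, hsq', Real.sqrt_sq (norm_nonneg _), Real.sqrt_sq (norm_nonneg _)]
  rw [hsq]
  have v1 : 8 * B * ‖α - θ‖ ≤ b * ‖α - β‖ := by
    calc 8 * B * ‖α - θ‖ ≤ C * b * δ := by gcongr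
      _ = b * (C * δ) := by ring
      _ ≤ _ := by gcongr
  have v2 : l * B * ∑ i, |α i - θ i| * |α i - β i| ≤ l * b / 8 * ‖α - β‖ ^ 2 := by
    calc l * B * ∑ i, |α i - θ i| * |α i - β i| ≤ l * B * (‖α - θ‖ * ‖α - β‖) := by gcongr
      _ = l / 8 * ‖α - β‖ * (8 * B * ‖α - θ‖) := by ring
      _ ≤ l / 8 * ‖α - β‖ * (b * ‖α - β‖) := by gcongr
      _ = _ := by ring
  have v3 : l * l * B / 2 - l * b / 2 ≤ -(3 * (l * b) / 8) := by
    nlinarith [mul_le_mul_of_nonneg_left hl2 hl0.le]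
  nlinarith [mul_le_mul_of_nonneg_right v3 (sq_nonneg ‖α - β‖)]

lemma measurableSet_dominates {n : ℕ} (α β : EuclideanSpace ℝ (Fin n)) :
    MeasurableSet {Y | Dominates F Y β α} := by
  have := F.measurable_T
  exact measurableSet_le (by fun_prop) measurable_const

end ExpFamily

end Likelihood

/-! ### Packings and local entropy -/

section Packing

variable {n : ℕ}

/-- The points of `S` are pairwise at distance more than `δ`. -/
def IsSep (δ : ℝ) (S : Finset (EuclideanSpace ℝ (Fin n))) : Prop :=
  ∀ x ∈ S, ∀ y ∈ S, x ≠ y → δ < ‖x - y‖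

lemma IsSep.mono {δ δ' : ℝ} {S S' : Finset (EuclideanSpace ℝ (Fin n))} (h : IsSep δ S)
    (hδ : δ' ≤ δ) (hS : S' ⊆ S) : IsSep δ' S' :=
  fun x hx y hy hxy => hδ.trans_lt (h x (hS hx) y (hS hy) hxy)

lemma IsSep.isSeparated {δ : ℝ} {S : Finset (EuclideanSpace ℝ (Fin n))} (h : IsSep δ S) :
    Metric.IsSeparated (δ.toNNReal : ℝ≥0∞) (S : Set (EuclideanSpace ℝ (Fin n))) := by
  intro x hx y hy hxy
  have h1 := h x hx y hy hxy
  rw [edist_dist, dist_eq_norm]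
  exact (ENNReal.ofReal_lt_ofReal_iff (norm_pos_iff.2 (sub_ne_zero.2 hxy))).2 h1

lemma IsSep.of_isSeparated {δ : ℝ} {S : Finset (EuclideanSpace ℝ (Fin n))}
    (h : Metric.IsSeparated (δ.toNNReal : ℝ≥0∞) (S : Set (EuclideanSpace ℝ (Fin n)))) :
    IsSep δ S := by
  intro x hx y hy hxy
  have h1 : (δ.toNNReal : ℝ≥0∞) < edist x y := h hx hy hxy
  rw [edist_dist, dist_eq_norm] at h1
  exact (ENNReal.ofReal_lt_ofReal_iff (norm_pos_iff.2 (sub_ne_zero.2 hxy))).1 h1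

lemma IsMaximalPacking.exists_near {δ : ℝ} (hδ : 0 ≤ δ) {K : Set (EuclideanSpace ℝ (Fin n))}
    {S : Finset (EuclideanSpace ℝ (Fin n))} (h : IsMaximalPacking δ K S)
    {x : EuclideanSpace ℝ (Fin n)} (hx : x ∈ K) : ∃ y ∈ S, ‖x - y‖ ≤ δ := by
  classical
  by_contra! hc
  have hxS : x ∉ S := fun hxS => by
    have := hc x hxS
    simp at this
    linarith
  have h2 := h.2 (y := insert x S) ⟨by
    rw [Finset.coe_insert]
    exact Set.insert_subset hx h.1.1, fun a ha b hb hab => by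
      rcases Finset.mem_insert.1 ha with rfl | ha' <;> rcases Finset.mem_insert.1 hb with rfl | hb'
      · exact absurd rfl hab
      · exact hc b hb'
      · rw [norm_sub_rev]
        exact hc a ha'
      · exact h.1.2 a ha' b hb' hab⟩ (Finset.subset_insert x S)
  exact hxS (h2 (Finset.mem_insert_self x S))

variable {K : Set (EuclideanSpace ℝ (Fin n))}

lemma localPackingNumber_lt_top (hK : Bornology.IsBounded K) {ε a : ℝ} (hε : 0 < ε) (ha : 0 < a) :
    localPackingNumber K ε a < ⊤ := by
  have hpos : 0 < ε / a := by positivity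
  set r : ℝ≥0 := (ε / a).toNNReal / 2 with hr
  have hr0 : r ≠ 0 := by
    rw [hr]
    have := Real.toNNReal_pos.2 hpos
    positivity
  have h2 : (ε / a).toNNReal = 2 * r := by
    rw [hr, mul_div_cancel₀ _ two_ne_zero]
  have htb : TotallyBounded K :=
    hK.isCompact_closure.totallyBounded.subset subset_closure
  have hfin : Metric.packingNumber (ε / a).toNNReal K < ⊤ := by
    rw [h2]
    refine (Metric.packingNumber_two_mul_le_externalCoveringNumber r K).trans_lt ?_
    obtain ⟨t, ht, hcov⟩ := Metric.totallyBounded_iff.1 htb r (by positivity)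
    have hc : Metric.IsCover r K t := by
      intro x hx
      obtain ⟨y, hy, hxy⟩ := Set.mem_iUnion₂.1 (hcov hx)
      exact ⟨y, hy, by
        change edist x y ≤ r
        rw [edist_dist, ← ENNReal.ofReal_coe_nnreal]
        exact ENNReal.ofReal_le_ofReal (Metric.mem_ball.1 hxy).le⟩
    exact (hc.externalCoveringNumber_le_encard).trans_lt ht.encard_lt_top
  refine lt_of_le_of_lt (iSup₂_le fun x _ => ?_) hfin
  refine iSup₂_le fun s hs => le_trans ?_ (le_iSup₂ (f := fun (C : Set _) (_ : C ⊆ K) =>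
    ⨆ (_ : Metric.IsSeparated ((ε / a).toNNReal : ℝ≥0∞) C), C.encard) s
      (hs.trans Set.inter_subset_right))
  exact le_rfl

/-- A packing of a ball is counted by the local packing number. -/
lemma IsSep.card_le_Nloc (hK : Bornology.IsBounded K) {ε a : ℝ} (hε : 0 < ε) (ha : 0 < a)
    {S : Finset (EuclideanSpace ℝ (Fin n))} {x : EuclideanSpace ℝ (Fin n)} (hx : x ∈ K)
    (hS : ∀ y ∈ S, y ∈ K ∧ ‖y - x‖ ≤ ε) (h : IsSep (ε / a) S) :
    (S.card : ℝ) ≤ Nloc K ε a := by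
  have h1 : (S.card : ℕ∞) ≤ localPackingNumber K ε a := by
    rw [← Set.encard_coe_eq_coe_finsetCard]
    refine le_trans ?_ (le_iSup₂ (f := fun θ (_ : θ ∈ K) =>
      Metric.packingNumber (ε / a).toNNReal (Metric.closedBall θ ε ∩ K)) x hx)
    refine h.isSeparated.encard_le_packingNumber fun y hy => ⟨?_, (hS y hy).1⟩
    rw [Metric.mem_closedBall, dist_eq_norm]
    exact (hS y hy).2
  have h2 := localPackingNumber_lt_top hK hε ha
  rw [Nloc, Nat.cast_le, ← ENat.natCast_le_natCast, ENat.natCast_toNat h2.ne]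
  exact h1

/-- The local packing number is attained, up to the choice of the centre, by a finite packing. -/
lemma exists_Nloc_eq_card (hK : Bornology.IsBounded K) (hne : K.Nonempty) {ε a : ℝ} (hε : 0 < ε)
    (ha : 0 < a) :
    ∃ x ∈ K, ∃ S : Finset (EuclideanSpace ℝ (Fin n)), (∀ y ∈ S, y ∈ K ∧ ‖y - x‖ ≤ ε) ∧
      IsSep (ε / a) S ∧ Nloc K ε a = S.card := by
  have h2 := localPackingNumber_lt_top hK hε ha
  obtain ⟨x₀, hx₀⟩ := hne
  have : Nonempty K := ⟨⟨x₀, hx₀⟩⟩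
  have h3 : localPackingNumber K ε a = ⨆ θ : K,
      Metric.packingNumber (ε / a).toNNReal
        (Metric.closedBall (θ : EuclideanSpace ℝ (Fin n)) ε ∩ K) :=
    iSup_subtype'
  rw [h3] at h2
  obtain ⟨x, hx⟩ := ENat.exists_eq_iSup_of_lt_top h2
  have hx' : Metric.packingNumber (ε / a).toNNReal
      (Metric.closedBall (x : EuclideanSpace ℝ (Fin n)) ε ∩ K) ≠ ⊤ := (hx.trans_lt h2).ne
  obtain ⟨s, hs, hsf, hsep, hcard⟩ := Metric.exists_set_encard_eq_packingNumber hx'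
  lift s to Finset (EuclideanSpace ℝ (Fin n)) using hsf
  refine ⟨x, x.2, s, fun y hy => ⟨(hs hy).2, ?_⟩, .of_isSeparated hsep, ?_⟩
  · have := (hs hy).1
    rwa [Metric.mem_closedBall, dist_eq_norm] at this
  · rw [Nloc, h3, ← hx, ← hcard, Set.encard_coe_eq_coe_finsetCard, ENat.toNat_natCast]

lemma one_le_Nloc (hK : Bornology.IsBounded K) (hne : K.Nonempty) {ε a : ℝ} (hε : 0 < ε)
    (ha : 0 < a) : 1 ≤ Nloc K ε a := by
  obtain ⟨x, hx⟩ := hne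
  have h : IsSep (ε / a) {x} := fun y hy z hz hyz => by
    simp only [Finset.mem_singleton] at hy hz
    exact absurd (hy.trans hz.symm) hyz
  have := h.card_le_Nloc hK hε ha hx (fun y hy => by
    rw [Finset.mem_singleton.1 hy]
    simpa using ⟨hx, hε.le⟩)
  simpa using this

/-- For a star-shaped set the local entropy decreases with the scale: a packing of a large ball is
contracted towards the centre of the star into a packing of a small ball. -/
lemma Nloc_anti (hK : Bornology.IsBounded K) {x₀ : EuclideanSpace ℝ (Fin n)} (hx₀ : x₀ ∈ K)
    (hstar : StarConvex ℝ x₀ K) {ε ε' a : ℝ} (hε : 0 < ε) (hεε' : ε ≤ ε') (ha : 0 < a) :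
    Nloc K ε' a ≤ Nloc K ε a := by
  classical
  have hε' : 0 < ε' := hε.trans_le hεε'
  obtain ⟨x, hx, S, hS, hsep, hcard⟩ := exists_Nloc_eq_card hK ⟨x₀, hx₀⟩ hε' ha
  set t := ε / ε' with ht
  have ht0 : 0 < t := by positivity
  have ht1 : t ≤ 1 := (div_le_one hε').2 hεε'
  set f : EuclideanSpace ℝ (Fin n) → EuclideanSpace ℝ (Fin n) := fun y => x₀ + t • (y - x₀)
  have hfK : ∀ y ∈ K, f y ∈ K := fun y hy => hstar.add_smul_sub_mem hy ht0.le ht1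
  have hf : ∀ y z, ‖f y - f z‖ = t * ‖y - z‖ := fun y z => by
    have : f y - f z = t • (y - z) := by
      simp only [f, smul_sub]
      abel
    rw [this, norm_smul, Real.norm_eq_abs, abs_of_pos ht0]
  have hinj : Function.Injective f := fun y z hyz => by
    have h1 := hf y z
    rw [hyz, sub_self, norm_zero] at h1
    have h2 : ‖y - z‖ = 0 := by
      rcases mul_eq_zero.1 h1.symm with h | h
      · exact absurd h ht0.ne'
      · exact h
    exact sub_eq_zero.1 (norm_eq_zero.1 h2)
  have hte : t * ε' = ε := div_mul_cancel₀ _ hε'.ne'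
  rw [hcard, ← Finset.card_image_of_injective S hinj]
  refine IsSep.card_le_Nloc hK hε ha (hfK x hx) (fun y hy => ?_) ?_
  · obtain ⟨z, hz, rfl⟩ := Finset.mem_image.1 hy
    refine ⟨hfK z (hS z hz).1, ?_⟩
    rw [hf, ← hte]
    exact mul_le_mul_of_nonneg_left (hS z hz).2 ht0.le
  · intro y hy z hz hyz
    obtain ⟨y', hy', rfl⟩ := Finset.mem_image.1 hy
    obtain ⟨z', hz', rfl⟩ := Finset.mem_image.1 hz
    rw [hf, ← hte, mul_div_assoc]
    exact mul_lt_mul_of_pos_left (hsep y' hy' z' hz' fun h => hyz (h ▸ rfl)) ht0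

lemma exists_isMaximalPacking (hK : Bornology.IsBounded K) {ε a : ℝ} (hε : 0 < ε) (ha : 0 < a)
    {x : EuclideanSpace ℝ (Fin n)} (hx : x ∈ K) :
    ∃ S, IsMaximalPacking (ε / a) (Metric.closedBall x ε ∩ K) S := by
  classical
  set P : Finset (EuclideanSpace ℝ (Fin n)) → Prop := fun S =>
    (S : Set (EuclideanSpace ℝ (Fin n))) ⊆ Metric.closedBall x ε ∩ K ∧
      ∀ x ∈ S, ∀ y ∈ S, x ≠ y → ε / a < ‖x - y‖ with hP
  have hbd : ∀ S, P S → S.card ≤ (localPackingNumber K ε a).toNat := fun S hS => by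
    have := IsSep.card_le_Nloc (S := S) hK hε ha hx (fun y hy => ⟨(hS.1 hy).2, by
      have := (hS.1 hy).1
      rwa [Metric.mem_closedBall, dist_eq_norm] at this⟩) hS.2
    rw [Nloc] at this
    exact_mod_cast this
  -- A packing of the largest cardinality is maximal under inclusion.
  have hfin : {k | ∃ S, P S ∧ S.card = k}.Finite :=
    (Set.finite_Iic (localPackingNumber K ε a).toNat).subset fun k hk => by
      obtain ⟨S, hS, rfl⟩ := hk
      exact hbd S hS
  obtain ⟨k, ⟨S, hS, rfl⟩, hmax⟩ := hfin.exists_maximal ⟨0, ∅, by simp [hP], rfl⟩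
  refine ⟨S, hS, fun S' hS' hle => ?_⟩
  have := hmax (y := S'.card) ⟨S', hS', rfl⟩ (Finset.card_le_card hle)
  exact (Finset.eq_of_subset_of_card_le hle this).symm.le

/-- Halving the packing radius: cover the ball by balls of half its radius and pack each of them. -/
lemma Nloc_two_mul_le_sq (hK : Bornology.IsBounded K) {x₀ : EuclideanSpace ℝ (Fin n)} (hx₀ : x₀ ∈ K)
    (hstar : StarConvex ℝ x₀ K) {ε a : ℝ} (hε : 0 < ε) (ha : 2 ≤ a) :
    Nloc K ε (2 * a) ≤ Nloc K (ε / 2) a ^ 2 := by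
  classical
  have ha0 : 0 < a := by linarith
  obtain ⟨x, hx, S, hS, hsep, hcard⟩ :=
    exists_Nloc_eq_card hK ⟨x₀, hx₀⟩ hε (by positivity : 0 < 2 * a)
  obtain ⟨R, hR⟩ := exists_isMaximalPacking hK hε ha0 hx
  have hRcard : (R.card : ℝ) ≤ Nloc K (ε / 2) a := by
    refine le_trans (IsSep.card_le_Nloc hK hε ha0 hx (fun y hy => ⟨(hR.1.1 hy).2, ?_⟩) hR.1.2)
      (Nloc_anti hK hx₀ hstar (by positivity) (by linarith) ha0)
    have := (hR.1.1 hy).1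
    rwa [Metric.mem_closedBall, dist_eq_norm] at this
  have hsub : S ⊆ R.biUnion fun z => S.filter fun y => ‖y - z‖ ≤ ε / 2 := fun y hy => by
    obtain ⟨z, hz, hyz⟩ := hR.exists_near (by positivity) (x := y)
      ⟨by rw [Metric.mem_closedBall, dist_eq_norm]; exact (hS y hy).2, (hS y hy).1⟩
    refine Finset.mem_biUnion.2 ⟨z, hz, Finset.mem_filter.2 ⟨hy, hyz.trans ?_⟩⟩
    exact div_le_div_of_nonneg_left hε.le two_pos ha
  have hone : ∀ z ∈ R, ((S.filter fun y => ‖y - z‖ ≤ ε / 2).card : ℝ) ≤ Nloc K (ε / 2) a :=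
    fun z hz => by
      refine IsSep.card_le_Nloc hK (by positivity) ha0 (hR.1.1 hz).2
        (fun y hy => ⟨(hS y (Finset.mem_filter.1 hy).1).1, (Finset.mem_filter.1 hy).2⟩)
        (IsSep.mono hsep ?_ (Finset.filter_subset _ _))
      rw [div_div]
  have hN : 0 ≤ Nloc K (ε / 2) a := Nat.cast_nonneg _
  calc Nloc K ε (2 * a) = S.card := hcard
    _ ≤ ((R.biUnion fun z => S.filter fun y => ‖y - z‖ ≤ ε / 2).card : ℝ) := by
        exact_mod_cast Finset.card_le_card hsub
    _ ≤ ∑ z ∈ R, ((S.filter fun y => ‖y - z‖ ≤ ε / 2).card : ℝ) := by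
        exact_mod_cast Finset.card_biUnion_le
    _ ≤ ∑ z ∈ R, Nloc K (ε / 2) a := Finset.sum_le_sum hone
    _ = R.card * Nloc K (ε / 2) a := by rw [Finset.sum_const, nsmul_eq_mul]
    _ ≤ Nloc K (ε / 2) a * Nloc K (ε / 2) a := by gcongr
    _ = _ := (sq _).symm

/-- At scales up to a quarter of the diameter a star-shaped set contains a segment that is long
enough to provide two separated points. -/
lemma two_le_Nloc (hK : Bornology.IsBounded K) {x₀ : EuclideanSpace ℝ (Fin n)} (hx₀ : x₀ ∈ K)
    (hstar : StarConvex ℝ x₀ K) {ε a : ℝ} (hε : 0 < ε) (hεd : ε ≤ Metric.diam K / 4) (ha : 1 < a) :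
    2 ≤ Nloc K ε a := by
  classical
  obtain ⟨y, hy, hyd⟩ : ∃ y ∈ K, Metric.diam K / 4 < ‖y - x₀‖ := by
    by_contra! hc
    have : Metric.diam K ≤ Metric.diam K / 2 := by
      refine Metric.diam_le_of_forall_dist_le (by positivity) fun y hy z hz => ?_
      have h1 := hc y hy
      have h2 := hc z hz
      have h3 := dist_triangle_right y z x₀
      rw [dist_eq_norm y x₀, dist_eq_norm z x₀] at h3
      linarith
    linarith
  have hpos : 0 < ‖y - x₀‖ := by linarith
  set t := ε / ‖y - x₀‖ with ht
  have ht0 : 0 < t := by positivity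
  have ht1 : t ≤ 1 := (div_le_one hpos).2 (by linarith)
  set z := x₀ + t • (y - x₀) with hz
  have hzK : z ∈ K := hstar.add_smul_sub_mem hy ht0.le ht1
  have hzd : ‖z - x₀‖ = ε := by
    rw [hz, add_sub_cancel_left, norm_smul, Real.norm_eq_abs, abs_of_pos ht0, ht,
      div_mul_cancel₀ _ hpos.ne']
  have hne : z ≠ x₀ := fun h => by
    rw [h, sub_self, norm_zero] at hzd
    linarith
  have hlt : ε / a < ε := div_lt_self hε ha
  have hsep : IsSep (ε / a) {z, x₀} := by
    intro u hu v hv huv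
    simp only [Finset.mem_insert, Finset.mem_singleton] at hu hv
    rcases hu with rfl | rfl <;> rcases hv with rfl | rfl
    · exact absurd rfl huv
    · rwa [hzd]
    · rwa [norm_sub_rev, hzd]
    · exact absurd rfl huv
  have := hsep.card_le_Nloc hK hε (by linarith) hx₀ (fun u hu => by
    simp only [Finset.mem_insert, Finset.mem_singleton] at hu
    rcases hu with rfl | rfl
    · exact ⟨hzK, hzd.le⟩
    · exact ⟨hx₀, by simpa using hε.le⟩)
  rw [Finset.card_pair hne] at this
  exact_mod_cast this

end Packing

/-! ### The pruned tree -/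

section PrunedTree

variable {n : ℕ}

lemma mem_filter_far {r : ℝ} (hr : 0 ≤ r) {l : List (EuclideanSpace ℝ (Fin n))}
    {u v : EuclideanSpace ℝ (Fin n)} (hv : v ∈ u :: l) (h : ¬ ‖v - u‖ ≤ r) :
    v ∈ l.filter fun w => decide (r < ‖w - u‖) := by
  rw [List.mem_filter]
  refine ⟨?_, by simpa using h⟩
  rcases List.mem_cons.1 hv with rfl | hv
  · simp [hr] at h
  · exact hv

lemma pruneRep_mem_and_near {r : ℝ} (hr : 0 ≤ r) (l : List (EuclideanSpace ℝ (Fin n))) :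
    ∀ v ∈ l, pruneRep r l v ∈ l ∧ ‖v - pruneRep r l v‖ ≤ r := by
  induction hk : l.length using Nat.strong_induction_on generalizing l with
  | _ k ih =>
  intro v hv
  cases l with
  | nil => simp at hv
  | cons u l =>
    rw [pruneRep]
    split_ifs with h
    · exact ⟨List.mem_cons_self, h⟩
    · have := ih _ (by rw [← hk]; exact Nat.lt_succ_of_le (List.length_filter_le _ _)) _ rfl v
        (mem_filter_far hr hv h)
      exact ⟨List.mem_cons_of_mem _ (List.mem_filter.1 this.1).1, this.2⟩

lemma pruneRep_sep {r : ℝ} (hr : 0 ≤ r) (l : List (EuclideanSpace ℝ (Fin n))) :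
    ∀ v ∈ l, ∀ w ∈ l, pruneRep r l v ≠ pruneRep r l w →
      r < ‖pruneRep r l v - pruneRep r l w‖ := by
  induction hk : l.length using Nat.strong_induction_on generalizing l with
  | _ k ih =>
  intro v hv w hw
  cases l with
  | nil => simp at hv
  | cons u l =>
    have hlt : (l.filter fun w => decide (r < ‖w - u‖)).length < k := by
      rw [← hk]
      exact Nat.lt_succ_of_le (List.length_filter_le _ _)
    -- Representatives chosen after `u` survive the removal of the points close to `u`.
    have hfar : ∀ x ∈ u :: l, ¬ ‖x - u‖ ≤ r →
        r < ‖pruneRep r (l.filter fun w => decide (r < ‖w - u‖)) x - u‖ := fun x hx hxu => by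
      have := (pruneRep_mem_and_near hr _ x (mem_filter_far hr hx hxu)).1
      simpa using (List.mem_filter.1 this).2
    rw [pruneRep, pruneRep]
    split_ifs with h1 h2 h2
    · exact fun h => absurd rfl h
    · intro _
      rw [norm_sub_rev]
      exact hfar w hw h2
    · intro _
      exact hfar v hv h1
    · exact ih _ hlt _ rfl v (mem_filter_far hr hv h1) w (mem_filter_far hr hw h2)

lemma mem_lexList {S : Finset (EuclideanSpace ℝ (Fin n))} {x : EuclideanSpace ℝ (Fin n)} :
    x ∈ lexList S ↔ x ∈ S := Finset.mem_sort _

lemma packRadius_le {d c : ℝ} (hd : 0 ≤ d) (hc : 0 < c) (m : ℕ) :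
    packRadius d c m ≤ d / (2 ^ m * c) := by
  unfold packRadius
  split_ifs with h
  · simp [h]
  · rw [pow_succ]
    apply div_le_div_of_nonneg_left hd (by positivity)
    have : 0 < (2 : ℝ) ^ m * c := by positivity
    linarith

lemma le_packRadius {d c : ℝ} (hd : 0 ≤ d) (hc : 0 < c) (m : ℕ) :
    d / (2 ^ (m + 1) * c) ≤ packRadius d c m := by
  unfold packRadius
  split_ifs with h
  · subst h
    apply div_le_div_of_nonneg_left hd (by positivity)
    norm_num
    linarith
  · exact le_rfl

section Tree

variable {K : Set (EuclideanSpace ℝ (Fin n))} {c : ℝ} {root : EuclideanSpace ℝ (Fin n)}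
  {pack : ℕ → EuclideanSpace ℝ (Fin n) → Finset (EuclideanSpace ℝ (Fin n))}

lemma packRadius_nonneg (hc : 0 < c) (m : ℕ) : 0 ≤ packRadius (Metric.diam K) c m :=
  le_trans (by positivity) (le_packRadius Metric.diam_nonneg hc m)

lemma offspring_subset_nodes {d : ℝ} {m : ℕ} {u : EuclideanSpace ℝ (Fin n)}
    (hu : u ∈ nodes d c root pack m) :
    offspring d c pack m (nodes d c root pack m) u ⊆ nodes d c root pack (m + 1) := by
  classical
  intro v hv
  rw [nodes]
  exact Finset.mem_biUnion.2 ⟨u, hu, hv⟩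

lemma mem_lexList_biUnion {m : ℕ} {L : Finset (EuclideanSpace ℝ (Fin n))}
    {u v : EuclideanSpace ℝ (Fin n)} (hu : u ∈ L) (hv : v ∈ pack m u)
    [DecidableEq (EuclideanSpace ℝ (Fin n))] :
    v ∈ lexList (L.biUnion (pack m)) :=
  mem_lexList.2 (Finset.mem_biUnion.2 ⟨u, hu, hv⟩)

lemma norm_le_of_mem_pack (hp : IsPackingChoice K c pack) {m : ℕ} {u v : EuclideanSpace ℝ (Fin n)}
    (hu : u ∈ K) (hv : v ∈ pack m u) : v ∈ K ∧ ‖v - u‖ ≤ Metric.diam K / 2 ^ m := by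
  have := (hp m u hu).1.1 hv
  rw [Set.mem_inter_iff, Metric.mem_closedBall, dist_eq_norm] at this
  exact this.symm

/-- Offspring stay in `K` and close to their parent. -/
lemma mem_offspring (hc : 1 ≤ c) (hp : IsPackingChoice K c pack) {m : ℕ}
    {L : Finset (EuclideanSpace ℝ (Fin n))} (hL : ∀ u ∈ L, u ∈ K)
    {u v : EuclideanSpace ℝ (Fin n)} (hu : u ∈ L)
    (hv : v ∈ offspring (Metric.diam K) c pack m L u) :
    v ∈ K ∧ ‖v - u‖ ≤ 2 * Metric.diam K / 2 ^ m := by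
  classical
  have hc0 : 0 < c := by linarith
  have hd : 0 ≤ Metric.diam K := Metric.diam_nonneg
  have hd' : 0 ≤ Metric.diam K / 2 ^ m := by positivity
  unfold offspring at hv
  split_ifs at hv with h
  · subst h
    have := norm_le_of_mem_pack hp (hL u hu) hv
    refine ⟨this.1, this.2.trans ?_⟩
    rw [mul_div_assoc]
    linarith
  · obtain ⟨w, hw, rfl⟩ := Finset.mem_image.1 hv
    obtain ⟨h1, h2⟩ := pruneRep_mem_and_near (packRadius_nonneg (K := K) hc0 m) _ w
      (mem_lexList_biUnion hu hw)
    constructor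
    · obtain ⟨u', hu', h3⟩ := Finset.mem_biUnion.1 (mem_lexList.1 h1)
      exact (norm_le_of_mem_pack hp (hL u' hu') h3).1
    · have h4 := (norm_le_of_mem_pack hp (hL u hu) hw).2
      have h5 : packRadius (Metric.diam K) c m ≤ Metric.diam K / 2 ^ m := by
        refine (packRadius_le hd hc0 m).trans ?_
        apply div_le_div_of_nonneg_left hd (by positivity)
        exact le_mul_of_one_le_right (by positivity) hc
      rw [norm_sub_rev] at h2
      have h6 := norm_sub_le_norm_sub_add_norm_sub
        (pruneRep (packRadius (Metric.diam K) c m) (lexList (L.biUnion (pack m))) w) w u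
      rw [mul_div_assoc]
      linarith

lemma mem_of_mem_nodes (hc : 1 ≤ c) (hp : IsPackingChoice K c pack) (hroot : root ∈ K) :
    ∀ m, ∀ u ∈ nodes (Metric.diam K) c root pack m, u ∈ K := by
  classical
  intro m
  induction m with
  | zero =>
    intro u hu
    rw [nodes, Finset.mem_singleton] at hu
    exact hu ▸ hroot
  | succ m ih =>
    intro u hu
    rw [nodes] at hu
    obtain ⟨v, hv, huv⟩ := Finset.mem_biUnion.1 hu
    exact (mem_offspring hc hp ih hv huv).1

/-- Pruning restores the separation of the nodes that the union of the packings has lost. -/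
lemma nodes_sep (hc : 1 ≤ c) (hp : IsPackingChoice K c pack) (hroot : root ∈ K) (m : ℕ) :
    IsSep (Metric.diam K / (2 ^ m * c)) (nodes (Metric.diam K) c root pack m) := by
  classical
  have hc0 : 0 < c := by linarith
  have hd : 0 ≤ Metric.diam K := Metric.diam_nonneg
  cases m with
  | zero =>
    intro x hx y hy hxy
    rw [nodes, Finset.mem_singleton] at hx hy
    exact absurd (hx.trans hy.symm) hxy
  | succ m =>
    intro x hx y hy hxy
    refine (le_packRadius hd hc0 m).trans_lt ?_
    rw [nodes] at hx hy
    obtain ⟨u, hu, hxu⟩ := Finset.mem_biUnion.1 hx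
    obtain ⟨v, hv, hyv⟩ := Finset.mem_biUnion.1 hy
    unfold offspring at hxu hyv
    split_ifs at hxu hyv with h
    · subst h
      rw [nodes, Finset.mem_singleton] at hu hv
      subst hu hv
      exact (hp 0 _ hroot).1.2 x hxu y hyv hxy
    · obtain ⟨x', hx', rfl⟩ := Finset.mem_image.1 hxu
      obtain ⟨y', hy', rfl⟩ := Finset.mem_image.1 hyv
      exact pruneRep_sep (packRadius_nonneg hc0 m) _ x' (mem_lexList_biUnion hu hx') y'
        (mem_lexList_biUnion hv hy') hxy

/-- Pruning at most doubles the covering radius of the offspring. -/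
lemma exists_near_offspring (hc : 1 ≤ c) (hp : IsPackingChoice K c pack) {m : ℕ}
    {L : Finset (EuclideanSpace ℝ (Fin n))} (hL : ∀ u ∈ L, u ∈ K)
    {u x : EuclideanSpace ℝ (Fin n)} (hu : u ∈ L) (hx : x ∈ K)
    (hxu : ‖x - u‖ ≤ Metric.diam K / 2 ^ m) :
    ∃ v ∈ offspring (Metric.diam K) c pack m L u, ‖v - x‖ ≤ Metric.diam K / (2 ^ m * c) := by
  classical
  have hc0 : 0 < c := by linarith
  have hd : 0 ≤ Metric.diam K := Metric.diam_nonneg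
  obtain ⟨w, hw, hxw⟩ := (hp m u (hL u hu)).exists_near (packRadius_nonneg hc0 m)
    (x := x) ⟨by rwa [Metric.mem_closedBall, dist_eq_norm], hx⟩
  unfold offspring
  split_ifs with h
  · refine ⟨w, h ▸ hw, ?_⟩
    rw [norm_sub_rev]
    exact hxw.trans (packRadius_le hd hc0 m)
  · refine ⟨_, Finset.mem_image_of_mem _ hw, ?_⟩
    have h1 := (pruneRep_mem_and_near (packRadius_nonneg (K := K) hc0 m) _ w
      (mem_lexList_biUnion hu hw)).2
    have h2 := norm_sub_le_norm_sub_add_norm_sub x w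
      (pruneRep (packRadius (Metric.diam K) c m) (lexList (L.biUnion (pack m))) w)
    rw [norm_sub_rev]
    have h3 : 2 * packRadius (Metric.diam K) c m = Metric.diam K / (2 ^ m * c) := by
      rw [packRadius, if_neg h]
      field_simp
      ring
    linarith

lemma card_offspring_le (hK : Bornology.IsBounded K) (hd : 0 < Metric.diam K) (hc : 1 ≤ c)
    (hp : IsPackingChoice K c pack) {m : ℕ}
    {L : Finset (EuclideanSpace ℝ (Fin n))} (hL : ∀ u ∈ L, u ∈ K)
    {u : EuclideanSpace ℝ (Fin n)} (hu : u ∈ L) :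
    ((offspring (Metric.diam K) c pack m L u).card : ℝ) ≤
      Nloc K (Metric.diam K / 2 ^ m) (2 * c) := by
  classical
  have hc0 : 0 < c := by linarith
  have h1 : (offspring (Metric.diam K) c pack m L u).card ≤ (pack m u).card := by
    unfold offspring
    split_ifs with h
    · rw [h]
    · exact Finset.card_image_le
  have h2 : IsSep (packRadius (Metric.diam K) c m) (pack m u) := (hp m u (hL u hu)).1.2
  refine (Nat.cast_le.2 h1).trans (IsSep.card_le_Nloc hK (by positivity) (by positivity) (hL u hu)
    (fun y hy => norm_le_of_mem_pack hp (hL u hu) hy) (h2.mono ?_ subset_rfl))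
  refine le_trans (le_of_eq ?_) (le_packRadius hd.le hc0 m)
  rw [div_div, pow_succ, mul_assoc]

/-- Only boundedly many nodes compete for being close to a given point. -/
lemma card_near_nodes_le (hK : Bornology.IsBounded K) (hd : 0 < Metric.diam K) (hc : 1 ≤ c)
    (hp : IsPackingChoice K c pack) (hroot : root ∈ K) {x : EuclideanSpace ℝ (Fin n)} (hx : x ∈ K)
    (m : ℕ) :
    (((nodes (Metric.diam K) c root pack m).filter
      fun u => ‖u - x‖ ≤ Metric.diam K / 2 ^ m).card : ℝ) ≤
      Nloc K (Metric.diam K / 2 ^ m) (2 * c) := by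
  have hc0 : 0 < c := by linarith
  refine IsSep.card_le_Nloc hK (by positivity) (by positivity) hx (fun y hy => ?_)
    ((nodes_sep hc hp hroot m).mono ?_ (Finset.filter_subset _ _))
  · rw [Finset.mem_filter] at hy
    exact ⟨mem_of_mem_nodes hc hp hroot m y hy.1, hy.2⟩
  · rw [div_div]
    apply div_le_div_of_nonneg_left hd.le (by positivity)
    have : 0 < (2 : ℝ) ^ m * c := by positivity
    linarith

end Tree

end PrunedTree

/-! ### The iterates of the algorithm -/

section Iterates

variable {n : ℕ} {𝒴 : Type*} [MeasurableSpace 𝒴] {F : ExpFamily 𝒴}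

lemma dominates_total (F : ExpFamily 𝒴) (Y : Fin n → 𝒴) (α β : EuclideanSpace ℝ (Fin n)) :
    Dominates F Y β α ∨ Dominates F Y α β := by
  have : ∑ i, ((α i - β i) * F.T (Y i) + F.cumulant (β i) - F.cumulant (α i)) =
      -∑ i, ((β i - α i) * F.T (Y i) + F.cumulant (α i) - F.cumulant (β i)) := by
    rw [← Finset.sum_neg_distrib]
    exact Finset.sum_congr rfl fun i _ => by ring
  unfold Dominates
  rw [this, Left.neg_nonpos_iff]
  exact le_total _ _

/-- If no far point of `S` dominates `α ∈ S`, then a minimiser of `H` is close to `α`: being far, it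
would be dominated by `α`, and so have a positive value of `H`. -/
lemma norm_sub_lt_of_H_minimal {Y : Fin n → 𝒴} {C δ : ℝ} {S : Finset (EuclideanSpace ℝ (Fin n))}
    {α v : EuclideanSpace ℝ (Fin n)} (hα : α ∈ S) (hv : v ∈ S)
    (hmin : H F Y C δ v S ≤ H F Y C δ α S)
    (hgood : ∀ β ∈ S, C * δ ≤ ‖α - β‖ → ¬ Dominates F Y β α) : ‖v - α‖ < C * δ := by
  classical
  by_contra! hfar
  have hfar' : C * δ ≤ ‖α - v‖ := by rwa [norm_sub_rev]
  have hnd := hgood v hv hfar'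
  have hd := (dominates_total F Y α v).resolve_left hnd
  have h0 : H F Y C δ α S = 0 := by
    unfold H
    rw [Finset.filter_eq_empty_iff.2, Finset.sup_empty, bot_eq_zero]
    exact fun β hβ h => hgood β hβ h.2 h.1
  have h1 : ‖v - α‖₊ ≤ H F Y C δ v S :=
    Finset.le_sup (f := fun β => ‖v - β‖₊) (Finset.mem_filter.2 ⟨hα, hd, hfar⟩)
  have h2 : ‖v - α‖₊ = 0 := le_antisymm (h0 ▸ h1.trans hmin) zero_le
  have h3 : v = α := sub_eq_zero.1 (nnnorm_eq_zero.1 h2)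
  subst h3
  exact hnd hd

section Algorithm

variable {K : Set (EuclideanSpace ℝ (Fin n))} {C : ℝ} {root : EuclideanSpace ℝ (Fin n)}
  {pack : ℕ → EuclideanSpace ℝ (Fin n) → Finset (EuclideanSpace ℝ (Fin n))}

lemma output_succ_spec (Y : Fin n → 𝒴) (m : ℕ)
    (hne : (offspring (Metric.diam K) (2 * (C + 1)) pack m
      (nodes (Metric.diam K) (2 * (C + 1)) root pack m) (output F K C root pack Y m)).Nonempty) :
    output F K C root pack Y (m + 1) ∈ offspring (Metric.diam K) (2 * (C + 1)) pack m
      (nodes (Metric.diam K) (2 * (C + 1)) root pack m) (output F K C root pack Y m) ∧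
    ∀ α ∈ offspring (Metric.diam K) (2 * (C + 1)) pack m
      (nodes (Metric.diam K) (2 * (C + 1)) root pack m) (output F K C root pack Y m),
      H F Y C (Metric.diam K / (2 ^ (m + 1) * (C + 1))) (output F K C root pack Y (m + 1))
        (offspring (Metric.diam K) (2 * (C + 1)) pack m
          (nodes (Metric.diam K) (2 * (C + 1)) root pack m) (output F K C root pack Y m)) ≤
      H F Y C (Metric.diam K / (2 ^ (m + 1) * (C + 1))) α
        (offspring (Metric.diam K) (2 * (C + 1)) pack m
          (nodes (Metric.diam K) (2 * (C + 1)) root pack m) (output F K C root pack Y m)) := by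
  rw [output]
  generalize output F K C root pack Y m = u at *
  generalize offspring (Metric.diam K) (2 * (C + 1)) pack m
      (nodes (Metric.diam K) (2 * (C + 1)) root pack m) u = S at *
  set f : EuclideanSpace ℝ (Fin n) → ℝ≥0 := fun θ =>
    H F Y C (Metric.diam K / (2 ^ (m + 1) * (C + 1))) θ S with hf
  cases h : (lexList S).argmin f with
  | none =>
    rw [List.argmin_eq_none] at h
    obtain ⟨x, hx⟩ := hne
    have := mem_lexList.2 hx
    simp [h] at this
  | some v =>
    rw [Option.getD_some]
    exact ⟨mem_lexList.1 (List.argmin_mem h), fun α hα =>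
      List.le_of_mem_argmin (mem_lexList.2 hα) h⟩

lemma offspring_nonempty (hC : 1 ≤ C) (hp : IsPackingChoice K (2 * (C + 1)) pack)
    (hroot : root ∈ K) {m : ℕ} {u : EuclideanSpace ℝ (Fin n)}
    (hu : u ∈ nodes (Metric.diam K) (2 * (C + 1)) root pack m) :
    (offspring (Metric.diam K) (2 * (C + 1)) pack m
      (nodes (Metric.diam K) (2 * (C + 1)) root pack m) u).Nonempty := by
  have hc : 1 ≤ 2 * (C + 1) := by linarith
  have hL := mem_of_mem_nodes hc hp hroot m
  have hd : 0 ≤ Metric.diam K := Metric.diam_nonneg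
  obtain ⟨v, hv, _⟩ := exists_near_offspring hc hp hL hu (hL u hu) (by
    rw [sub_self, norm_zero]; positivity)
  exact ⟨v, hv⟩

lemma output_mem_nodes (hC : 1 ≤ C) (hp : IsPackingChoice K (2 * (C + 1)) pack)
    (hroot : root ∈ K) (Y : Fin n → 𝒴) : ∀ m, output F K C root pack Y m ∈
      nodes (Metric.diam K) (2 * (C + 1)) root pack m := by
  intro m
  induction m with
  | zero => simp [output, nodes]
  | succ m ih =>
    exact offspring_subset_nodes ih (output_succ_spec Y m (offspring_nonempty hC hp hroot ih)).1

lemma output_mem (hC : 1 ≤ C) (hp : IsPackingChoice K (2 * (C + 1)) pack)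
    (hroot : root ∈ K) (Y : Fin n → 𝒴) (m : ℕ) : output F K C root pack Y m ∈ K :=
  mem_of_mem_nodes (by linarith) hp hroot m _ (output_mem_nodes hC hp hroot Y m)

lemma norm_output_succ_sub_le (hC : 1 ≤ C) (hp : IsPackingChoice K (2 * (C + 1)) pack)
    (hroot : root ∈ K) (Y : Fin n → 𝒴) (m : ℕ) :
    ‖output F K C root pack Y (m + 1) - output F K C root pack Y m‖ ≤
      2 * Metric.diam K / 2 ^ m := by
  have hu := output_mem_nodes (F := F) hC hp hroot Y m
  have hc : 1 ≤ 2 * (C + 1) := by linarith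
  exact (mem_offspring hc hp (mem_of_mem_nodes hc hp hroot m) hu
    (output_succ_spec Y m (offspring_nonempty hC hp hroot hu)).1).2

/-- The steps of the algorithm decay geometrically, so that all later iterates stay near. -/
lemma norm_output_add_sub_le (hC : 1 ≤ C) (hp : IsPackingChoice K (2 * (C + 1)) pack)
    (hroot : root ∈ K) (Y : Fin n → 𝒴) (m k : ℕ) :
    ‖output F K C root pack Y (m + k) - output F K C root pack Y m‖ ≤
      4 * Metric.diam K / 2 ^ m - 4 * Metric.diam K / 2 ^ (m + k) := by
  induction k with
  | zero => simp
  | succ k ih =>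
    have h1 := norm_output_succ_sub_le (F := F) hC hp hroot Y (m + k)
    have h2 := norm_sub_le_norm_sub_add_norm_sub (output F K C root pack Y (m + k + 1))
      (output F K C root pack Y (m + k)) (output F K C root pack Y m)
    have h3 : 4 * Metric.diam K / 2 ^ (m + (k + 1)) = 2 * Metric.diam K / 2 ^ (m + k) := by
      rw [← add_assoc, pow_succ]
      field_simp
      ring
    have h4 : 4 * Metric.diam K / 2 ^ (m + k) = 2 * (2 * Metric.diam K / 2 ^ (m + k)) := by ring
    rw [← add_assoc] at *
    linarith

/-- A stage fails only if some likelihood comparison goes wrong. The union bound runs over the nodes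
that are close to the truth and over their offspring; both are counted by the local entropy. -/
lemma exists_failure_event {q : ℝ} (hq : 0 < q) (hK : Bornology.IsBounded K)
    (hd : 0 < Metric.diam K) (hC : 1 ≤ C) (hp : IsPackingChoice K (2 * (C + 1)) pack)
    (hroot : root ∈ K) {θ : EuclideanSpace ℝ (Fin n)} (hθ : θ ∈ K)
    [IsProbabilityMeasure (F.jointLaw θ)]
    (hprob : ∀ α ∈ K, ∀ β ∈ K, ∀ δ, ‖α - θ‖ ≤ δ → C * δ ≤ ‖α - β‖ →
      (F.jointLaw θ).real {Y | Dominates F Y β α} ≤ Real.exp (-(q * ‖α - β‖ ^ 2))) (m : ℕ) :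
    ∃ E : Set (Fin n → 𝒴), MeasurableSet E ∧
      (F.jointLaw θ).real E ≤ Nloc K (Metric.diam K / 2 ^ m) (2 * (2 * (C + 1))) ^ 2 *
        Real.exp (-(q * (C * (Metric.diam K / (2 ^ m * (2 * (C + 1))))) ^ 2)) ∧
      ∀ Y ∉ E, ‖output F K C root pack Y m - θ‖ ≤ Metric.diam K / 2 ^ m →
        ‖output F K C root pack Y (m + 1) - θ‖ ≤ Metric.diam K / 2 ^ (m + 1) := by
  classical
  have hc : 1 ≤ 2 * (C + 1) := by linarith
  set d := Metric.diam K with hd_def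
  set c := 2 * (C + 1) with hc_def
  set L := nodes d c root pack m with hL_def
  have hL : ∀ u ∈ L, u ∈ K := mem_of_mem_nodes hc hp hroot m
  set δ := d / (2 ^ m * c) with hδ
  have hδ0 : 0 < δ := by positivity
  have hδ' : d / (2 ^ (m + 1) * (C + 1)) = δ := by
    rw [hδ, hc_def, pow_succ, mul_assoc]
  set near := L.filter fun u => ‖u - θ‖ ≤ d / 2 ^ m with hnear
  have hex : ∀ u ∈ near, ∃ α ∈ offspring d c pack m L u, ‖α - θ‖ ≤ δ := fun u hu => by
    rw [hnear, Finset.mem_filter] at hu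
    exact exists_near_offspring hc hp hL hu.1 hθ (by rw [norm_sub_rev]; exact hu.2)
  choose! a ha hanear using hex
  have hoff : ∀ u ∈ near, ∀ β ∈ offspring d c pack m L u, β ∈ K := fun u hu β hβ =>
    (mem_offspring hc hp hL (Finset.mem_filter.1 hu).1 hβ).1
  set far : EuclideanSpace ℝ (Fin n) → Finset (EuclideanSpace ℝ (Fin n)) := fun u =>
    (offspring d c pack m L u).filter fun β => C * δ ≤ ‖a u - β‖ with hfar
  set N := Nloc K (d / 2 ^ m) (2 * c) with hN
  have hN0 : 0 ≤ N := Nat.cast_nonneg _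
  refine ⟨⋃ u ∈ near, ⋃ β ∈ far u, {Y | Dominates F Y β (a u)}, ?_, ?_, ?_⟩
  · exact Finset.measurableSet_biUnion _ fun u _ => Finset.measurableSet_biUnion _ fun β _ =>
      F.measurableSet_dominates _ _
  · have hone : ∀ u ∈ near, ∀ β ∈ far u, (F.jointLaw θ).real {Y | Dominates F Y β (a u)} ≤
        Real.exp (-(q * (C * δ) ^ 2)) := fun u hu β hβ => by
      rw [hfar, Finset.mem_filter] at hβ
      refine (hprob _ (hoff u hu _ (ha u hu)) _ (hoff u hu β hβ.1) δ (hanear u hu) hβ.2).trans ?_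
      rw [Real.exp_le_exp, neg_le_neg_iff]
      have : 0 ≤ C * δ := by positivity
      gcongr
      exact hβ.2
    have hfarcard : ∀ u ∈ near, ((far u).card : ℝ) ≤ N := fun u hu =>
      (Nat.cast_le.2 (Finset.card_filter_le _ _)).trans
        (card_offspring_le hK hd hc hp hL (Finset.mem_filter.1 hu).1)
    calc (F.jointLaw θ).real (⋃ u ∈ near, ⋃ β ∈ far u, {Y | Dominates F Y β (a u)})
        ≤ ∑ u ∈ near, (F.jointLaw θ).real (⋃ β ∈ far u, {Y | Dominates F Y β (a u)}) :=
          measureReal_biUnion_finset_le _ _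
      _ ≤ ∑ u ∈ near, ∑ β ∈ far u, (F.jointLaw θ).real {Y | Dominates F Y β (a u)} :=
          Finset.sum_le_sum fun u _ => measureReal_biUnion_finset_le _ _
      _ ≤ ∑ u ∈ near, ∑ β ∈ far u, Real.exp (-(q * (C * δ) ^ 2)) :=
          Finset.sum_le_sum fun u hu => Finset.sum_le_sum fun β hβ => hone u hu β hβ
      _ ≤ ∑ u ∈ near, N * Real.exp (-(q * (C * δ) ^ 2)) := by
          refine Finset.sum_le_sum fun u hu => ?_
          rw [Finset.sum_const, nsmul_eq_mul]
          exact mul_le_mul_of_nonneg_right (hfarcard u hu) (Real.exp_nonneg _)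
      _ = near.card * (N * Real.exp (-(q * (C * δ) ^ 2))) := by
          rw [Finset.sum_const, nsmul_eq_mul]
      _ ≤ N * (N * Real.exp (-(q * (C * δ) ^ 2))) := by
          gcongr
          exact card_near_nodes_le hK hd hc hp hroot hθ m
      _ = _ := by ring
  · intro Y hY hYm
    have hu := output_mem_nodes (F := F) hC hp hroot Y m
    have hspec := output_succ_spec (F := F) Y m (offspring_nonempty hC hp hroot hu)
    set u := output F K C root pack Y m with hu_def
    have hun : u ∈ near := Finset.mem_filter.2 ⟨hu, hYm⟩
    have hgood : ∀ β ∈ offspring d c pack m L u, C * δ ≤ ‖a u - β‖ →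
        ¬ Dominates F Y β (a u) := fun β hβ hfarβ hdom => hY <| by
      simp only [Set.mem_iUnion]
      exact ⟨u, hun, β, Finset.mem_filter.2 ⟨hβ, hfarβ⟩, hdom⟩
    have hlt := norm_sub_lt_of_H_minimal (C := C) (δ := δ) (ha u hun) hspec.1
      (hδ' ▸ hspec.2 _ (ha u hun)) hgood
    have htri := norm_sub_le_norm_sub_add_norm_sub (output F K C root pack Y (m + 1)) (a u) θ
    have hcδ : (C + 1) * δ = d / 2 ^ (m + 1) := by
      rw [← hδ']
      field_simp
    have := hanear u hun
    rw [← hcδ]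
    linarith

/-- The error is controlled by the scale at which the first failure occurs. -/
lemma norm_output_sub_sq_le (hC : 1 ≤ C) (hp : IsPackingChoice K (2 * (C + 1)) pack)
    (hroot : root ∈ K) (hK : Bornology.IsBounded K) {θ : EuclideanSpace ℝ (Fin n)} (hθ : θ ∈ K)
    {E : ℕ → Set (Fin n → 𝒴)}
    (hE : ∀ m, ∀ Y ∉ E m, ‖output F K C root pack Y m - θ‖ ≤ Metric.diam K / 2 ^ m →
        ‖output F K C root pack Y (m + 1) - θ‖ ≤ Metric.diam K / 2 ^ (m + 1))
    (Y : Fin n → 𝒴) {J m : ℕ} (hJ : J ≤ m) :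
    ‖output F K C root pack Y m - θ‖ ^ 2 ≤ 25 * (Metric.diam K / 2 ^ J) ^ 2 +
      ∑ j ∈ Finset.range J, 25 * (Metric.diam K / 2 ^ j) ^ 2 * (E j).indicator 1 Y := by
  have hd : 0 ≤ Metric.diam K := Metric.diam_nonneg
  have hlater : ∀ j ≤ m, ‖output F K C root pack Y j - θ‖ ≤ Metric.diam K / 2 ^ j →
      ‖output F K C root pack Y m - θ‖ ^ 2 ≤ 25 * (Metric.diam K / 2 ^ j) ^ 2 := by
    intro j hj h
    obtain ⟨k, rfl⟩ := Nat.exists_eq_add_of_le hj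
    have h1 := norm_output_add_sub_le (F := F) hC hp hroot Y j k
    have h2 := norm_sub_le_norm_sub_add_norm_sub (output F K C root pack Y (j + k))
      (output F K C root pack Y j) θ
    have h3 : 0 ≤ 4 * Metric.diam K / 2 ^ (j + k) := by positivity
    have h4 : 4 * Metric.diam K / 2 ^ j = 4 * (Metric.diam K / 2 ^ j) := by ring
    have h5 : ‖output F K C root pack Y (j + k) - θ‖ ≤ 5 * (Metric.diam K / 2 ^ j) := by linarith
    calc _ ≤ (5 * (Metric.diam K / 2 ^ j)) ^ 2 := by gcongr
      _ = _ := by ring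
  have hterm : ∀ j, 0 ≤ 25 * (Metric.diam K / 2 ^ j) ^ 2 *
      (E j).indicator (1 : (Fin n → 𝒴) → ℝ) Y :=
    fun j => mul_nonneg (by positivity) (Set.indicator_nonneg (fun _ _ => zero_le_one) _)
  have hfirst : ∀ i, (∃ j < i, Y ∈ E j ∧ ‖output F K C root pack Y j - θ‖ ≤ Metric.diam K / 2 ^ j) ∨
      ‖output F K C root pack Y i - θ‖ ≤ Metric.diam K / 2 ^ i := by
    intro i
    induction i with
    | zero =>
      right
      rw [pow_zero, div_one, ← dist_eq_norm]
      exact Metric.dist_le_diam_of_mem hK (output_mem hC hp hroot Y 0) hθ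
    | succ i ih =>
      rcases ih with ⟨j, hj, h⟩ | h
      · exact Or.inl ⟨j, hj.trans i.lt_succ_self, h⟩
      · by_cases hY : Y ∈ E i
        · exact Or.inl ⟨i, i.lt_succ_self, hY, h⟩
        · exact Or.inr (hE i Y hY h)
  rcases hfirst J with ⟨j, hj, hY, h⟩ | h
  · have h1 := hlater j (hj.le.trans hJ) h
    have h2 := Finset.single_le_sum (fun j _ => hterm j) (Finset.mem_range.2 hj)
    rw [Set.indicator_of_mem hY, Pi.one_apply, mul_one] at h2
    have : 0 ≤ 25 * (Metric.diam K / 2 ^ J) ^ 2 := by positivity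
    linarith
  · have h1 := hlater J hJ h
    have := Finset.sum_nonneg fun j (_ : j ∈ Finset.range J) => hterm j
    linarith

lemma H_congr {Y Y' : Fin n → 𝒴} {C δ : ℝ} {α : EuclideanSpace ℝ (Fin n)}
    {S : Finset (EuclideanSpace ℝ (Fin n))}
    (h : ∀ β ∈ S, Dominates F Y β α ↔ Dominates F Y' β α) : H F Y C δ α S = H F Y' C δ α S := by
  classical
  unfold H
  congr 1
  exact Finset.filter_congr fun β hβ => by rw [h β hβ]

lemma argmin_congr {ι : Type*} {β : Type*} [LinearOrder β] {f g : ι → β} {l : List ι}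
    (h : ∀ x ∈ l, f x = g x) : l.argmin f = l.argmin g := by
  cases hv : l.argmin f with
  | none =>
    rw [List.argmin_eq_none] at hv
    simp [hv]
  | some v =>
    classical
    symm
    rw [List.argmin_eq_some_iff] at hv ⊢
    refine ⟨hv.1, fun a ha => ?_, fun a ha hle => hv.2.2 a ha ?_⟩
    · rw [← h v hv.1, ← h a ha]
      exact hv.2.1 a ha
    · rwa [h v hv.1, h a ha]

/-- The output depends on the data only through the comparisons between the nodes of the tree. -/
lemma output_congr (hC : 1 ≤ C) (hp : IsPackingChoice K (2 * (C + 1)) pack)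
    (hroot : root ∈ K) {Y Y' : Fin n → 𝒴} {m : ℕ} {U : Set (EuclideanSpace ℝ (Fin n))}
    (hU : ∀ j ≤ m, ∀ u ∈ nodes (Metric.diam K) (2 * (C + 1)) root pack j, u ∈ U)
    (h : ∀ α ∈ U, ∀ β ∈ U, Dominates F Y β α ↔ Dominates F Y' β α) :
    output F K C root pack Y m = output F K C root pack Y' m := by
  have key : ∀ j ≤ m, output F K C root pack Y j = output F K C root pack Y' j := by
    intro j
    induction j with
    | zero => exact fun _ => rfl
    | succ j ih =>
      intro hj
      have ih := ih (by omega)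
      have hsub := offspring_subset_nodes (output_mem_nodes (F := F) hC hp hroot Y j)
      rw [output, output]
      rw [← ih]
      congr 1
      refine argmin_congr fun x hx => H_congr fun β hβ => h x ?_ β ?_
      · exact hU _ hj _ (hsub (mem_lexList.1 hx))
      · exact hU _ hj _ (hsub hβ)
  exact key m le_rfl

/-- The output is a function of finitely many comparisons, each of which is a measurable event. -/
lemma measurable_output (hC : 1 ≤ C) (hp : IsPackingChoice K (2 * (C + 1)) pack)
    (hroot : root ∈ K) (m : ℕ) : Measurable fun Y => output F K C root pack Y m := by
  classical
  set U : Finset (EuclideanSpace ℝ (Fin n)) :=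
    (Finset.range (m + 1)).biUnion (nodes (Metric.diam K) (2 * (C + 1)) root pack) with hU
  let D : (Fin n → 𝒴) → (U × U → Prop) := fun Y p => Dominates F Y p.1 p.2
  have hD : Measurable D := measurable_pi_iff.2 fun p =>
    measurableSet_setOfPred.1 (F.measurableSet_dominates _ _)
  have hDout : ∀ Y Y', D Y = D Y' → output F K C root pack Y m = output F K C root pack Y' m := by
    intro Y Y' hYY'
    refine output_congr hC hp hroot (U := U) (fun j hj u hu => ?_) fun α hα β hβ => ?_
    · exact Finset.mem_biUnion.2 ⟨j, Finset.mem_range.2 (by omega), hu⟩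
    · exact iff_of_eq (congrFun hYY' (⟨β, hβ⟩, ⟨α, hα⟩))
  intro s _
  have : (fun Y => output F K C root pack Y m) ⁻¹' s =
      D ⁻¹' (D '' ((fun Y => output F K C root pack Y m) ⁻¹' s)) := by
    refine (Set.subset_preimage_image _ _).antisymm fun Y hY => ?_
    obtain ⟨Y', hY', h⟩ := hY
    rw [Set.mem_preimage] at hY' ⊢
    rwa [hDout Y Y' h.symm]
  rw [this]
  exact hD (Set.toFinite _).measurableSet

end Algorithm

end Iterates

/-! ### Risk of the iterates -/

section Risk

/-- A sum over scales of `y exp (-a y)` is dominated by its last, finest scale. -/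
lemma sum_sq_mul_exp_le {a D : ℝ} (ha : 0 < a) (hD : 0 < D) (J : ℕ) :
    ∑ j ∈ Finset.range J, (D / 2 ^ j) ^ 2 * Real.exp (-(a * (D / 2 ^ j) ^ 2)) ≤
      1 / (a ^ 2 * (D / 2 ^ J) ^ 2) := by
  induction J with
  | zero =>
    rw [Finset.sum_range_zero]
    positivity
  | succ J ih =>
    rw [Finset.sum_range_succ]
    set y := (D / 2 ^ J) ^ 2 with hy
    have hy0 : 0 < y := by positivity
    have h1 : (D / 2 ^ (J + 1)) ^ 2 = y / 4 := by
      rw [hy, pow_succ (2 : ℝ) J, ← div_div, div_pow]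
      norm_num
    have h2 : y * Real.exp (-(a * y)) ≤ 2 / (a ^ 2 * y) := by
      have h3 := Real.quadratic_le_exp_of_nonneg (x := a * y) (by positivity)
      have h4 : (a * y) ^ 2 / 2 ≤ Real.exp (a * y) := by
        have : 0 ≤ a * y := by positivity
        linarith
      rw [Real.exp_neg, le_div_iff₀ (by positivity), ← div_eq_mul_inv, div_mul_eq_mul_div,
        div_le_iff₀ (Real.exp_pos _)]
      nlinarith
    have h5 : 1 / (a ^ 2 * (y / 4)) = 4 * (1 / (a ^ 2 * y)) := by
      field_simp
    have h6 : 2 / (a ^ 2 * y) = 2 * (1 / (a ^ 2 * y)) := by ring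
    have h7 : 0 ≤ 1 / (a ^ 2 * y) := by positivity
    rw [h1, h5]
    linarith

variable {n : ℕ} {𝒴 : Type*} [MeasurableSpace 𝒴] {F : ExpFamily 𝒴}
  {K : Set (EuclideanSpace ℝ (Fin n))} {C : ℝ} {root : EuclideanSpace ℝ (Fin n)}
  {pack : ℕ → EuclideanSpace ℝ (Fin n) → Finset (EuclideanSpace ℝ (Fin n))}

lemma log_Nloc_le_log_Nloc (hK : Bornology.IsBounded K) {x₀ : EuclideanSpace ℝ (Fin n)}
    (hx₀ : x₀ ∈ K) (hstar : StarConvex ℝ x₀ K) {ε ε' a : ℝ} (hε : 0 < ε) (hεε' : ε ≤ ε')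
    (ha : 0 < a) : Real.log (Nloc K ε' a) ≤ Real.log (Nloc K ε a) :=
  Real.log_le_log (zero_lt_one.trans_le (one_le_Nloc hK ⟨x₀, hx₀⟩ (hε.trans_le hεε') ha))
    (Nloc_anti hK hx₀ hstar hε hεε' ha)

lemma norm_output_sub_le_diam (hC : 1 ≤ C) (hp : IsPackingChoice K (2 * (C + 1)) pack)
    (hroot : root ∈ K) (hK : Bornology.IsBounded K) {θ : EuclideanSpace ℝ (Fin n)} (hθ : θ ∈ K)
    (Y : Fin n → 𝒴) (m : ℕ) : ‖output F K C root pack Y m - θ‖ ≤ Metric.diam K := by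
  rw [← dist_eq_norm]
  exact Metric.dist_le_diam_of_mem hK (output_mem hC hp hroot Y m) hθ

lemma integrable_norm_output_sub_sq (hC : 1 ≤ C) (hp : IsPackingChoice K (2 * (C + 1)) pack)
    (hroot : root ∈ K) (hK : Bornology.IsBounded K) {θ : EuclideanSpace ℝ (Fin n)} (hθ : θ ∈ K)
    [IsProbabilityMeasure (F.jointLaw θ)] (m : ℕ) :
    Integrable (fun Y => ‖output F K C root pack Y m - θ‖ ^ 2) (F.jointLaw θ) := by
  have hm := measurable_output (F := F) hC hp hroot m
  refine Integrable.of_bound (by fun_prop) (Metric.diam K ^ 2) (ae_of_all _ fun Y => ?_)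
  rw [Real.norm_eq_abs, abs_of_nonneg (by positivity)]
  have := norm_output_sub_le_diam (F := F) hC hp hroot hK hθ Y m
  gcongr

lemma integral_norm_output_sub_sq_le_diam_sq (hC : 1 ≤ C)
    (hp : IsPackingChoice K (2 * (C + 1)) pack) (hroot : root ∈ K) (hK : Bornology.IsBounded K)
    {θ : EuclideanSpace ℝ (Fin n)} (hθ : θ ∈ K) [IsProbabilityMeasure (F.jointLaw θ)] (m : ℕ) :
    ∫ Y, ‖output F K C root pack Y m - θ‖ ^ 2 ∂(F.jointLaw θ) ≤ Metric.diam K ^ 2 := by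
  have := integral_mono (integrable_norm_output_sub_sq (F := F) hC hp hroot hK hθ m)
    (integrable_const (Metric.diam K ^ 2)) (fun Y => by
      have := norm_output_sub_le_diam (F := F) hC hp hroot hK hθ Y m
      dsimp only
      gcongr)
  simpa using this

/-- As long as the local entropy at all coarser scales is beaten by the comparison error, the risk
is of the order of the squared scale `d / 2 ^ J`. -/
lemma integral_norm_output_sub_sq_le {q a : ℝ} (hq : 0 < q) (hK : Bornology.IsBounded K)
    (hd : 0 < Metric.diam K) (hC : 1 ≤ C) (hp : IsPackingChoice K (2 * (C + 1)) pack)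
    (hroot : root ∈ K) {θ : EuclideanSpace ℝ (Fin n)} (hθ : θ ∈ K)
    [IsProbabilityMeasure (F.jointLaw θ)]
    (hprob : ∀ α ∈ K, ∀ β ∈ K, ∀ δ, ‖α - θ‖ ≤ δ → C * δ ≤ ‖α - β‖ →
      (F.jointLaw θ).real {Y | Dominates F Y β α} ≤ Real.exp (-(q * ‖α - β‖ ^ 2)))
    (ha : a = q * C ^ 2 / (2 * (2 * (C + 1)) ^ 2)) {J m : ℕ} (hJ : J ≤ m)
    (hent : ∀ j < J, 2 * Real.log (Nloc K (Metric.diam K / 2 ^ j) (2 * (2 * (C + 1)))) ≤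
      a * (Metric.diam K / 2 ^ j) ^ 2) :
    ∫ Y, ‖output F K C root pack Y m - θ‖ ^ 2 ∂(F.jointLaw θ) ≤
      25 * ((Metric.diam K / 2 ^ J) ^ 2 + 1 / (a ^ 2 * (Metric.diam K / 2 ^ J) ^ 2)) := by
  have ha0 : 0 < a := by rw [ha]; positivity
  choose E hEm hEp hE using exists_failure_event hq hK hd hC hp hroot hθ hprob
  have hp' : ∀ j < J, (F.jointLaw θ).real (E j) ≤
      Real.exp (-(a * (Metric.diam K / 2 ^ j) ^ 2)) := fun j hj => by
    refine (hEp j).trans ?_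
    have hN := one_le_Nloc hK ⟨θ, hθ⟩ (by positivity : 0 < Metric.diam K / 2 ^ j)
      (by positivity : 0 < 2 * (2 * (C + 1)))
    have h1 : Nloc K (Metric.diam K / 2 ^ j) (2 * (2 * (C + 1))) ^ 2 ≤
        Real.exp (a * (Metric.diam K / 2 ^ j) ^ 2) := by
      rw [← Real.log_le_iff_le_exp (by positivity), Real.log_pow]
      exact_mod_cast hent j hj
    have h2 : q * (C * (Metric.diam K / (2 ^ j * (2 * (C + 1))))) ^ 2 =
        2 * (a * (Metric.diam K / 2 ^ j) ^ 2) := by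
      rw [ha]
      field_simp
    calc _ ≤ Real.exp (a * (Metric.diam K / 2 ^ j) ^ 2) *
          Real.exp (-(q * (C * (Metric.diam K / (2 ^ j * (2 * (C + 1))))) ^ 2)) := by gcongr
      _ = _ := by
        rw [h2, ← Real.exp_add]
        congr 1
        ring
  have hint : ∀ j, Integrable (fun Y => 25 * (Metric.diam K / 2 ^ j) ^ 2 *
      (E j).indicator (1 : (Fin n → 𝒴) → ℝ) Y) (F.jointLaw θ) := fun j =>
    ((integrable_const (1 : ℝ)).indicator (hEm j)).const_mul _
  have h1 := integral_mono (integrable_norm_output_sub_sq (F := F) hC hp hroot hK hθ m)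
    ((integrable_const (25 * (Metric.diam K / 2 ^ J) ^ 2)).add
      (integrable_finsetSum (Finset.range J) fun j _ => hint j))
    (fun Y => norm_output_sub_sq_le hC hp hroot hK hθ hE Y hJ)
  refine h1.trans ?_
  simp only [Pi.add_apply]
  rw [integral_add (integrable_const _) (integrable_finsetSum _ fun j _ => hint j),
    integral_finsetSum _ fun j _ => hint j]
  have h3 : ∀ j, ∫ Y, 25 * (Metric.diam K / 2 ^ j) ^ 2 *
      (E j).indicator (1 : (Fin n → 𝒴) → ℝ) Y ∂(F.jointLaw θ) =
      25 * (Metric.diam K / 2 ^ j) ^ 2 * (F.jointLaw θ).real (E j) := fun j => by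
    rw [integral_const_mul, integral_indicator_one (hEm j)]
  simp_rw [h3]
  rw [integral_const, probReal_univ, one_smul, mul_add]
  have h4 := sum_sq_mul_exp_le ha0 hd J
  have h5 : ∑ j ∈ Finset.range J, 25 * (Metric.diam K / 2 ^ j) ^ 2 * (F.jointLaw θ).real (E j) ≤
      25 * ∑ j ∈ Finset.range J,
        (Metric.diam K / 2 ^ j) ^ 2 * Real.exp (-(a * (Metric.diam K / 2 ^ j) ^ 2)) := by
    rw [Finset.mul_sum]
    refine Finset.sum_le_sum fun j hj => ?_
    rw [mul_assoc]
    gcongr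
    exact hp' j (Finset.mem_range.1 hj)
  linarith

/-! ### The stopping level and the critical scale -/

lemma epsJ_eq (k : ℕ) :
    epsJ K C (k + 2) = Metric.diam K / 2 ^ (k + 1) / (C + 1) := by
  rw [epsJ, div_div]
  rfl

lemma epsJ_eq_two_mul {J : ℕ} (hJ : 1 ≤ J) : epsJ K C J = 2 * epsJ K C (J + 1) := by
  obtain ⟨k, rfl⟩ := Nat.exists_eq_add_of_le' hJ
  rw [epsJ, epsJ, Nat.add_sub_cancel, Nat.add_sub_cancel, pow_succ]
  field_simp

lemma bddAbove_JCondition (hC : 1 ≤ C) {κ : ℝ} (hκ : 0 < κ) :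
    BddAbove {J : ℕ | 1 ≤ J ∧ JCondition K κ C J} := by
  refine ⟨⌈κ * Metric.diam K ^ 2 / Real.log 2⌉₊, fun J hJ => ?_⟩
  obtain ⟨h1, h2⟩ := hJ
  have h3 : Real.log 2 < κ * epsJ K C J ^ 2 := (le_max_right _ _).trans_lt h2
  have hlog : 0 < Real.log 2 := Real.log_pos one_lt_two
  have h4 : (J : ℝ) ≤ (2 ^ (J - 1)) ^ 2 := by
    have h5 : J ≤ 2 ^ (J - 1) := by
      have := (J - 1).lt_two_pow_self
      omega
    have h6 : (J : ℝ) ≤ 2 ^ (J - 1) := by exact_mod_cast h5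
    have h7 : (1 : ℝ) ≤ 2 ^ (J - 1) := one_le_pow₀ one_le_two
    nlinarith
  have h8 : epsJ K C J ^ 2 * J ≤ Metric.diam K ^ 2 := by
    have hd : 0 ≤ Metric.diam K := Metric.diam_nonneg
    calc epsJ K C J ^ 2 * J ≤ epsJ K C J ^ 2 * (2 ^ (J - 1)) ^ 2 := by gcongr
      _ = (Metric.diam K / (C + 1)) ^ 2 := by
        rw [epsJ]
        field_simp
      _ ≤ _ := by
        gcongr
        exact div_le_self hd (by linarith)
  rw [← Nat.cast_le (α := ℝ)]
  refine le_trans ?_ (Nat.le_ceil _)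
  rw [le_div_iff₀ hlog]
  nlinarith [mul_le_mul_of_nonneg_left h8 hκ.le,
    mul_le_mul_of_nonneg_right h3.le (Nat.cast_nonneg J)]

lemma one_le_Jstar (κ : ℝ) : 1 ≤ Jstar K κ C := le_max_left _ _

/-- Above level one, `J*` is a genuine maximum, not the default value. -/
lemma JCondition_Jstar (hC : 1 ≤ C) {κ : ℝ} (hκ : 0 < κ) (h : 2 ≤ Jstar K κ C) :
    JCondition K κ C (Jstar K κ C) := by
  have h1 : Jstar K κ C = sSup {J : ℕ | 1 ≤ J ∧ JCondition K κ C J} := by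
    rw [Jstar] at h ⊢
    omega
  have hne : {J : ℕ | 1 ≤ J ∧ JCondition K κ C J}.Nonempty := by
    by_contra hne
    rw [Set.not_nonempty_iff_eq_empty] at hne
    rw [hne, csSup_empty] at h1
    simp [h1] at h
  have := Nat.sSup_mem hne (bddAbove_JCondition hC hκ)
  rw [← h1] at this
  exact this.2

lemma not_JCondition_Jstar_succ (hC : 1 ≤ C) {κ : ℝ} (hκ : 0 < κ) :
    ¬ JCondition K κ C (Jstar K κ C + 1) := fun h => by
  have h1 := le_csSup (bddAbove_JCondition hC hκ) (a := Jstar K κ C + 1) ⟨by omega, h⟩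
  have h2 : sSup {J : ℕ | 1 ≤ J ∧ JCondition K κ C J} ≤ Jstar K κ C := le_max_right _ _
  omega

lemma bddAbove_epsStar (hK : Bornology.IsBounded K) {x₀ : EuclideanSpace ℝ (Fin n)}
    (hx₀ : x₀ ∈ K) (hstar : StarConvex ℝ x₀ K) {κ a : ℝ} (hκ : 0 < κ) (ha : 0 < a) :
    BddAbove {ε : ℝ | 0 ≤ ε ∧ κ * ε ^ 2 ≤ Real.log (Nloc K ε a)} := by
  refine ⟨max 1 (Real.log (Nloc K 1 a) / κ), fun ε hε => ?_⟩
  rcases le_total ε 1 with h | h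
  · exact le_max_of_le_left h
  · refine le_max_of_le_right ?_
    have h1 := hε.2.trans (log_Nloc_le_log_Nloc hK hx₀ hstar one_pos h ha)
    rw [le_div_iff₀ hκ]
    nlinarith [mul_le_mul_of_nonneg_left h hκ.le]

/-- The scale at which the algorithm stops is at most of the order of the critical scale: at the
next finer scale either the entropy term or the constant `log 2` wins, and both are bounded by the
local entropy at a comparable scale. -/
lemma epsJ_Jstar_le (hK : Bornology.IsBounded K) (hd : 0 < Metric.diam K)
    {x₀ : EuclideanSpace ℝ (Fin n)} (hx₀ : x₀ ∈ K) (hstar : StarConvex ℝ x₀ K) (hC : 1 ≤ C) {κ : ℝ}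
    (hκ : 0 < κ) : epsJ K C (Jstar K κ C) ≤ 6 * epsStar K κ C := by
  have hJ := one_le_Jstar (K := K) (C := C) κ
  rw [epsJ_eq_two_mul hJ]
  have hn := not_JCondition_Jstar_succ (K := K) hC hκ
  set ε := epsJ K C (Jstar K κ C + 1) with hε
  set c := 2 * (C + 1) with hc
  have hc0 : 2 ≤ c := by linarith
  have hε0 : 0 < ε := by rw [hε, epsJ]; positivity
  have hmem : ∀ r, 0 ≤ r → κ * r ^ 2 ≤ Real.log (Nloc K r c) → r ≤ epsStar K κ C := fun r h1 h2 =>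
    le_csSup (bddAbove_epsStar hK hx₀ hstar hκ (by linarith)) ⟨h1, h2⟩
  rw [JCondition, gt_iff_lt, not_lt, le_max_iff] at hn
  rcases hn with hn | hn
  · have h1 := Nloc_two_mul_le_sq hK hx₀ hstar (by positivity : 0 < c * ε) hc0
    have hN1 := one_le_Nloc hK ⟨x₀, hx₀⟩ (by positivity : 0 < c * ε)
      (by positivity : 0 < 2 * c)
    have hN2 := one_le_Nloc hK ⟨x₀, hx₀⟩ (by positivity : 0 < c * ε / 2)
      (by positivity : 0 < c)
    have h2 := Real.log_le_log (by linarith) h1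
    rw [Real.log_pow] at h2 hn
    push_cast at h2 hn
    have h3 := Real.log_nonneg hN2
    have h4 : ε / 3 ≤ c * ε / 2 := by nlinarith
    have h5 := log_Nloc_le_log_Nloc hK hx₀ hstar (by positivity : 0 < ε / 3) h4
      (by positivity : 0 < c)
    have h6 : κ * (ε / 3) ^ 2 = κ * ε ^ 2 / 9 := by ring
    have := hmem (ε / 3) (by positivity) (by rw [h6]; linarith)
    linarith
  · have hεd : ε ≤ Metric.diam K / 4 := by
      rw [hε, epsJ]
      apply div_le_div_of_nonneg_left hd.le (by norm_num)
      have : (2 : ℝ) ^ 1 ≤ 2 ^ (Jstar K κ C + 1 - 1) :=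
        pow_le_pow_right₀ one_le_two (by omega)
      nlinarith
    have h2 := two_le_Nloc hK hx₀ hstar hε0 hεd (by linarith : 1 < c)
    have h3 := Real.log_le_log two_pos h2
    have := hmem ε hε0.le (hn.trans h3)
    linarith

/-- The risk bound in terms of the stopping scale. The number `s` of levels given up makes the
comparison error beat the entropy even when `κ` is large. -/
lemma integral_norm_output_sub_sq_le_epsJ_sq {q a κ : ℝ} {s : ℕ} (hq : 0 < q) (hκ : 0 < κ)
    (hK : Bornology.IsBounded K) (hd : 0 < Metric.diam K) {x₀ : EuclideanSpace ℝ (Fin n)}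
    (hx₀ : x₀ ∈ K) (hstar : StarConvex ℝ x₀ K) (hC : 1 ≤ C)
    (hp : IsPackingChoice K (2 * (C + 1)) pack)
    (hroot : root ∈ K) {θ : EuclideanSpace ℝ (Fin n)} (hθ : θ ∈ K)
    [IsProbabilityMeasure (F.jointLaw θ)]
    (hprob : ∀ α ∈ K, ∀ β ∈ K, ∀ δ, ‖α - θ‖ ≤ δ → C * δ ≤ ‖α - β‖ →
      (F.jointLaw θ).real {Y | Dominates F Y β α} ≤ Real.exp (-(q * ‖α - β‖ ^ 2)))
    (ha : a = q * C ^ 2 / (2 * (2 * (C + 1)) ^ 2)) (hs : κ ≤ 4 ^ s * (q * C ^ 2)) {m : ℕ}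
    (hm : Jstar K κ C ≤ m + 1) :
    ∫ Y, ‖output F K C root pack Y m - θ‖ ^ 2 ∂(F.jointLaw θ) ≤
      max ((C + 1) ^ 2)
        (25 * (4 ^ s * (C + 1) ^ 2 + (κ / Real.log 2) ^ 2 / (a ^ 2 * (C + 1) ^ 2))) *
        epsJ K C (Jstar K κ C) ^ 2 := by
  have ha0 : 0 < a := by rw [ha]; positivity
  rcases (one_le_Jstar (K := K) (C := C) κ).eq_or_lt with h1 | h1
  · refine (integral_norm_output_sub_sq_le_diam_sq hC hp hroot hK hθ m).trans ?_
    refine le_trans (le_of_eq ?_) (mul_le_mul_of_nonneg_right (le_max_left _ _) (sq_nonneg _))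
    rw [← h1, epsJ]
    field_simp
    norm_num
  · have hcond := JCondition_Jstar hC hκ h1
    obtain ⟨k, hk⟩ := Nat.exists_eq_add_of_le' h1
    change Jstar K κ C = k + 2 at hk
    rw [hk] at hcond hm ⊢
    set d := Metric.diam K with hd_def
    set ε := epsJ K C (k + 2) with hε
    have hεk : ε = d / 2 ^ (k + 1) / (C + 1) := epsJ_eq k
    have hε0 : 0 < ε := by rw [hεk]; positivity
    have hcε : 2 * (C + 1) * ε = d / 2 ^ k := by
      rw [hεk, pow_succ]
      field_simp
    have hyk : (d / 2 ^ (k + 1)) ^ 2 = (C + 1) ^ 2 * ε ^ 2 := by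
      rw [hεk]
      field_simp
    rw [JCondition, hcε, Real.log_pow, gt_iff_lt, max_lt_iff] at hcond
    obtain ⟨hent, hlog⟩ := hcond
    push_cast at hent
    have hl2 : 0 < Real.log 2 := Real.log_pos one_lt_two
    have hscale : ∀ i j : ℕ, i ≤ j → d / 2 ^ j ≤ d / 2 ^ i := fun i j hij =>
      div_le_div_of_nonneg_left hd.le (by positivity) (pow_le_pow_right₀ one_le_two hij)
    have hshift : ∀ i : ℕ, (d / 2 ^ i) ^ 2 = 4 ^ s * (d / 2 ^ (i + s)) ^ 2 := fun i => by
      rw [pow_add, show (4 : ℝ) = 2 ^ 2 by norm_num, ← pow_mul, mul_comm 2 s, pow_mul]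
      field_simp
    -- Giving up `s` levels gains a factor `4 ^ s` in `(d / 2 ^ j) ^ 2` over `ε ^ 2`.
    have hmain := integral_norm_output_sub_sq_le (J := k + 1 - s) (m := m) hq hK hd hC hp hroot hθ
      hprob ha (by omega) (fun j hj => by
        have e1 := log_Nloc_le_log_Nloc hK hx₀ hstar (by positivity : 0 < d / 2 ^ k)
          (hscale j k (by omega)) (by positivity : 0 < 2 * (2 * (C + 1)))
        have e2 : 2 * Real.log (Nloc K (d / 2 ^ j) (2 * (2 * (C + 1)))) ≤ κ * ε ^ 2 / 2 := by
          linarith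
        have e3 : ε ^ 2 = (d / 2 ^ k) ^ 2 / (2 * (C + 1)) ^ 2 := by
          rw [← hcε]
          field_simp
        have e4 : (d / 2 ^ k) ^ 2 ≤ (d / 2 ^ (j + s)) ^ 2 := by
          have := hscale (j + s) k (by omega)
          gcongr
        calc _ ≤ κ * ε ^ 2 / 2 := e2
          _ ≤ 4 ^ s * (q * C ^ 2) * ((d / 2 ^ (j + s)) ^ 2 / (2 * (C + 1)) ^ 2) / 2 := by
            rw [e3]
            gcongr
          _ = a * (d / 2 ^ j) ^ 2 := by
            rw [hshift j, ha]
            field_simp)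
    refine hmain.trans (le_trans ?_ (mul_le_mul_of_nonneg_right (le_max_right _ _) (sq_nonneg _)))
    have f1 : (d / 2 ^ (k + 1 - s)) ^ 2 ≤ 4 ^ s * (C + 1) ^ 2 * ε ^ 2 := by
      rw [hshift, mul_assoc, ← hyk]
      have := hscale (k + 1) (k + 1 - s + s) (by omega)
      gcongr
    have f2 : (C + 1) ^ 2 * ε ^ 2 ≤ (d / 2 ^ (k + 1 - s)) ^ 2 := by
      rw [← hyk]
      have := hscale (k + 1 - s) (k + 1) (by omega)
      gcongr
    have f3 : 1 / (a ^ 2 * (d / 2 ^ (k + 1 - s)) ^ 2) ≤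
        (κ / Real.log 2) ^ 2 / (a ^ 2 * (C + 1) ^ 2) * ε ^ 2 := by
      calc 1 / (a ^ 2 * (d / 2 ^ (k + 1 - s)) ^ 2) ≤ 1 / (a ^ 2 * ((C + 1) ^ 2 * ε ^ 2)) := by
            gcongr
        _ = 1 / (a ^ 2 * (C + 1) ^ 2) * (1 / ε ^ 4 * ε ^ 2) := by field_simp
        _ ≤ 1 / (a ^ 2 * (C + 1) ^ 2) * ((κ / Real.log 2) ^ 2 * ε ^ 2) := by
          gcongr
          rw [show ε ^ 4 = (ε ^ 2) ^ 2 by ring, ← one_div_pow]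
          have : 1 / ε ^ 2 ≤ κ / Real.log 2 := by
            rw [div_le_div_iff₀ (by positivity) hl2]
            linarith
          gcongr
        _ = _ := by ring
    linarith

end Risk

end

end StarExpFamily

theorem mainTheorem2 {𝒴 : Type*} [MeasurableSpace 𝒴] (F : StarExpFamily.ExpFamily 𝒴)
    (M : ℝ) (hM : 0 < M)
    (hnat : Set.Icc (-M) M ⊆ interior F.naturalSpace)
    (hsmooth : ContDiffOn ℝ 2 F.cumulant (interior F.naturalSpace))
    (hvar : ∀ t ∈ Set.Icc (-M) M, 0 < variance F.T (F.law t)) :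
    ∃ C₀ > 0, ∀ C ≥ C₀, ∀ κ > 0, ∃ L > 0,
      ∀ (n : ℕ) (K : Set (EuclideanSpace ℝ (Fin n))),
        (∃ x₀ ∈ K, StarConvex ℝ x₀ K) →
        (∀ x ∈ K, ∀ i, x i ∈ Set.Icc (-M) M) →
        ∀ root ∈ K,
        ∀ pack : ℕ → EuclideanSpace ℝ (Fin n) → Finset (EuclideanSpace ℝ (Fin n)),
        StarExpFamily.IsPackingChoice K (2 * (C + 1)) pack →
        ∀ θ ∈ K, ∀ m : ℕ, StarExpFamily.Jstar K κ C ≤ m + 1 →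
          Integrable
            (fun Y => ‖StarExpFamily.output F K C root pack Y m - θ‖ ^ 2) (F.jointLaw θ) ∧
          ∫ Y, ‖StarExpFamily.output F K C root pack Y m - θ‖ ^ 2 ∂(F.jointLaw θ) ≤
            L * min (StarExpFamily.epsJ K C (StarExpFamily.Jstar K κ C) ^ 2)
              (Metric.diam K ^ 2) ∧
          ∫ Y, ‖StarExpFamily.output F K C root pack Y m - θ‖ ^ 2 ∂(F.jointLaw θ) ≤
            L * min (StarExpFamily.epsStar K κ C ^ 2) (Metric.diam K ^ 2) := by
  obtain ⟨C₀, hC₀, q, hq, hprob⟩ := F.exists_dominates_prob_le hM hnat hvar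
  refine ⟨C₀, by linarith, fun C hC κ hκ => ?_⟩
  have hC1 : 1 ≤ C := le_trans hC₀ hC
  have hqC : 0 < q * C ^ 2 := by positivity
  obtain ⟨s, hs⟩ := pow_unbounded_of_one_lt (κ / (q * C ^ 2)) (by norm_num : (1 : ℝ) < 4)
  have hs' : κ ≤ 4 ^ s * (q * C ^ 2) := by
    rw [div_lt_iff₀ hqC] at hs
    exact hs.le
  obtain ⟨a, ha⟩ : ∃ a, a = q * C ^ 2 / (2 * (2 * (C + 1)) ^ 2) := ⟨_, rfl⟩
  obtain ⟨L₁, hL₁⟩ : ∃ L₁, L₁ = max ((C + 1) ^ 2)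
    (25 * (4 ^ s * (C + 1) ^ 2 + (κ / Real.log 2) ^ 2 / (a ^ 2 * (C + 1) ^ 2))) := ⟨_, rfl⟩
  have hL1 : 1 ≤ L₁ := by
    rw [hL₁]
    exact le_max_of_le_left (by nlinarith)
  refine ⟨36 * L₁, by linarith, ?_⟩
  rintro n K ⟨x₀, hx₀, hstar⟩ hKM root hroot pack hp θ hθ m hm
  have hK : Bornology.IsBounded K := by
    have h1 : WithLp.ofLp '' K ⊆ Set.Icc (fun _ => -M) (fun _ => M) := by
      rintro _ ⟨x, hx, rfl⟩
      exact ⟨fun i => (hKM x hx i).1, fun i => (hKM x hx i).2⟩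
    have h2 : Bornology.IsBounded (WithLp.ofLp '' K) := (Metric.isBounded_Icc _ _).subset h1
    have h3 := (PiLp.antilipschitzWith_ofLp 2 (fun _ : Fin n => ℝ)).isBounded_preimage h2
    exact h3.subset (Set.subset_preimage_image _ _)
  have hF := F.carrier_ne_zero_of_variance_pos (hvar 0 ⟨by linarith, hM.le⟩)
  have hlaw : ∀ i, IsProbabilityMeasure (F.law (θ i)) := fun i =>
    F.isProbabilityMeasure_law hF (interior_subset (hnat (hKM θ hθ i)))
  have hjoint : IsProbabilityMeasure (F.jointLaw θ) := by
    unfold StarExpFamily.ExpFamily.jointLaw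
    infer_instance
  have hdiam := StarExpFamily.integral_norm_output_sub_sq_le_diam_sq (F := F) hC1 hp hroot hK hθ m
  refine ⟨StarExpFamily.integrable_norm_output_sub_sq hC1 hp hroot hK hθ m, ?_⟩
  -- If `K` is a single point, all iterates equal `θ`.
  rcases (Metric.diam_nonneg (s := K)).eq_or_lt with hd | hd
  · rw [← hd] at hdiam ⊢
    simp only [ne_eq, OfNat.ofNat_ne_zero, not_false_eq_true, zero_pow] at hdiam ⊢
    rw [min_eq_right (sq_nonneg _), min_eq_right (sq_nonneg _), mul_zero]
    exact ⟨hdiam, hdiam⟩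
  · have hmain := StarExpFamily.integral_norm_output_sub_sq_le_epsJ_sq (F := F) hq hκ hK hd hx₀
      hstar hC1 hp hroot hθ (fun α hα β hβ δ h1 h2 =>
        hprob C hC n θ α β δ (hKM θ hθ) (hKM α hα) (hKM β hβ) h1 h2) ha hs' hm
    rw [← hL₁] at hmain
    have hle := StarExpFamily.epsJ_Jstar_le hK hd hx₀ hstar hC1 hκ
    have hε0 : 0 ≤ StarExpFamily.epsJ K C (StarExpFamily.Jstar K κ C) := by
      unfold StarExpFamily.epsJ
      positivity
    have hsq : StarExpFamily.epsJ K C (StarExpFamily.Jstar K κ C) ^ 2 ≤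
        36 * StarExpFamily.epsStar K κ C ^ 2 := by nlinarith
    have hd2 : 0 ≤ Metric.diam K ^ 2 := sq_nonneg _
    have hε2 := sq_nonneg (StarExpFamily.epsJ K C (StarExpFamily.Jstar K κ C))
    have hdL : Metric.diam K ^ 2 ≤ 36 * L₁ * Metric.diam K ^ 2 := by nlinarith
    constructor
    · rw [mul_min_of_nonneg _ _ (by linarith)]
      exact le_min (by nlinarith) (hdiam.trans hdL)
    · rw [mul_min_of_nonneg _ _ (by linarith)]
      exact le_min (by nlinarith) (hdiam.trans hdL)
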